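/- Let $G=(V,E)$ be a connected, locally finite graph with countable vertex set $V$ and symmetric edge set $E\subseteq V\times V$ (edges are undirected, and loops are allowed), and let $0<p<1$ and $q\ge 1$. For a finite (multi)graph $H$, the random cluster measure $\mathsf{FRC}^{H}(p,q)$ is the probability measure on $\{0,1\}^{E(H)}$ that gives $\omega$ probability proportional to $q^{\|\omega\|}\prod_{e\in E(H)}p^{\omega(e)}(1-p)^{1-\omega(e)}$, where $\|\omega\|$ is the number of connected components of the graph $(V(H),\{e:\omega(e)=1\})$. An exhaustion of $G$ is an increasing sequence of finite sets $V_n\subseteq V$ with $\bigcup_n V_n=V$; let $G_n$ be the subgraph of $G$ induced by $V_n$, and let $G_n^*$ be obtained from $G_n$ by identifying to a single vertex all vertices of $V_n$ that have a neighbor outside $V_n$. Then: (a) There is a unique probability measure $\mathsf{FRC}^G(p,q)$ on $\{0,1\}^E$ that is the weak$^*$ limit of $\mathsf{FRC}^{G_n}(p,q)$ along every exhaustion (the free random cluster measure), and a unique probability measure $\mathsf{WRC}^G(p,q)$ on $\{0,1\}^E$ that is the weak$^*$ limit of $\mathsf{FRC}^{G_n^*}(p,q)$ along every exhaustion (the wired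 random cluster measure). Here a measure on the configurations of the edges of $G_n$ is regarded as a measure on $\{0,1\}^E$ by declaring all other edges closed (state $0$). (b) Both $\mathsf{FRC}^G(p,q)$ and $\mathsf{WRC}^G(p,q)$ have a trivial tail $\sigma$-field: every event in $\bigcap_{K\subseteq E\text{ finite}}\sigma(\omega(e):e\in E\setminus K)$ has probability $0$ or $1$. (c) In particular, both measures are ergodic: if $\Gamma$ is a group of automorphisms of $G$ such that some vertex of $G$ has an infinite $\Gamma$-orbit (for example, $\Gamma=\mathrm{Aut}(G)$ with $G$ infinite and transitive), then both measures are $\Gamma$-invariant, and every event $A$ such that $\gamma A$ and $A$ differ by a null set for each $\gamma\in\Gamma$ has probability $0$ or $1$. -/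

import Mathlib

open MeasureTheory Filter Topology

/-!
A graph with vertex set `V` is given by its set `E : Set (Sym2 V)` of undirected edges
(loops are allowed).  A bond configuration is a function `E → Bool`; `true` means open.
-/

namespace RandomCluster

/-- Every vertex has finitely many neighbours. -/
def LocallyFinite {V : Type*} (E : Set (Sym2 V)) : Prop :=
  ∀ x : V, {y : V | s(x, y) ∈ E}.Finite

/-- Bond configurations, with the product topology and the product sigma-field. -/
abbrev Config {V : Type*} (E : Set (Sym2 V)) : Type _ := E → Bool

section FiniteGraph

/-! A finite multigraph has vertex type `W`, edge type `F`, and endpoints `ends : F → Sym2 W`. -/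

variable {W F : Type*}

/-- The number of connected components of the graph on all of `W` formed by the open edges. -/
noncomputable def numComponents (ends : F → Sym2 W) (ω : F → Bool) : ℕ :=
  Nat.card (SimpleGraph.fromEdgeSet {z : Sym2 W | ∃ e, ω e = true ∧ ends e = z}).ConnectedComponent

/-- The Bernoulli(`p`) weight of `ω` times `q` to the number of components of `ω`. -/
noncomputable def rcWeight [Fintype F] (p q : ℝ) (ends : F → Sym2 W) (ω : F → Bool) : ℝ :=
  (∏ e, if ω e = true then p else 1 - p) * q ^ numComponents ends ω

open Classical in
/-- The random cluster measure with parameters `(p, q)` on a finite multigraph. -/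
noncomputable def rcMeasure [Fintype F] (p q : ℝ) (ends : F → Sym2 W) : Measure (F → Bool) :=
  ∑ ω : F → Bool,
    ENNReal.ofReal (rcWeight p q ends ω / ∑ η : F → Bool, rcWeight p q ends η) • Measure.dirac ω

end FiniteGraph

section Volumes

variable {V : Type*} (E : Set (Sym2 V)) (Λ : Finset V)

/-- The edges of the subgraph induced by `Λ`. -/
def inducedEdges : Set E := {e | ∀ x ∈ (e : Sym2 V), x ∈ Λ}

/-- Endpoints in the induced subgraph. -/
def inducedEnds (e : inducedEdges E Λ) : Sym2 {x : V // x ∈ Λ} :=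
  (e.1 : Sym2 V).attachWith e.2

theorem attachWith_injective {V : Type*} (P : V → Prop) (z w : Sym2 V) (hz : ∀ x ∈ z, P x)
    (hw : ∀ x ∈ w, P x) (h : z.attachWith hz = w.attachWith hw) : z = w := by
  have := congrArg (Sym2.map Subtype.val) h
  simpa using this

instance inducedEdges_finite : Finite (inducedEdges E Λ) := by
  apply Finite.of_injective (inducedEnds E Λ)
  intro e e' h
  exact Subtype.ext (Subtype.ext (attachWith_injective _ _ _ e.2 e'.2 h))

noncomputable instance inducedEdges_fintype : Fintype (inducedEdges E Λ) := Fintype.ofFinite _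

/-- The internal vertex boundary of `Λ`. -/
def internalBoundary : Set V := {x | x ∈ Λ ∧ ∃ y, y ∉ Λ ∧ s(x, y) ∈ E}

/-- The equivalence relation on `Λ` that identifies all internal boundary vertices. -/
def wiring : Setoid {x : V // x ∈ Λ} where
  r x y := x = y ∨ ((x : V) ∈ internalBoundary E Λ ∧ (y : V) ∈ internalBoundary E Λ)
  iseqv :=
    { refl := fun _ => Or.inl rfl
      symm := by
        rintro x y (h | ⟨h, h'⟩)
        · exact Or.inl h.symm
        · exact Or.inr ⟨h', h⟩
      trans := by
        rintro x y z (rfl | ⟨h, h'⟩) (rfl | ⟨k, k'⟩)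
        · exact Or.inl rfl
        · exact Or.inr ⟨k, k'⟩
        · exact Or.inr ⟨h, h'⟩
        · exact Or.inr ⟨h, k'⟩ }

/-- Endpoints in the induced subgraph after the internal boundary is identified to one vertex. -/
def wiredEnds (e : inducedEdges E Λ) : Sym2 (Quotient (wiring E Λ)) :=
  (inducedEnds E Λ e).map (Quotient.mk (wiring E Λ))

open Classical in
/-- A configuration on the induced subgraph, extended to all of `E` by closed edges. -/
noncomputable def extendConfig (ω : inducedEdges E Λ → Bool) : Config E :=
  fun e => if h : e ∈ inducedEdges E Λ then ω ⟨e, h⟩ else false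

/-- The random cluster measure of the subgraph induced by `Λ`, as a measure on `Config E`. -/
noncomputable def freeVolume (p q : ℝ) : Measure (Config E) :=
  (rcMeasure p q (inducedEnds E Λ)).map (extendConfig E Λ)

/-- The random cluster measure of the subgraph induced by `Λ` with its internal boundary
identified to one vertex, as a measure on `Config E`. -/
noncomputable def wiredVolume (p q : ℝ) : Measure (Config E) :=
  (rcMeasure p q (wiredEnds E Λ)).map (extendConfig E Λ)

end Volumes

/-- An increasing sequence of finite vertex sets with union `V`. -/
structure IsExhaustion {V : Type*} (Λ : ℕ → Finset V) : Prop where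
  mono : Monotone Λ
  exhausts : ∀ x, ∃ n, x ∈ Λ n

/-- Weak-star convergence of a sequence of measures on `Config E`. -/
def WeakLimit {V : Type*} {E : Set (Sym2 V)} (ν : ℕ → Measure (Config E))
    (μ : Measure (Config E)) : Prop :=
  ∀ f : C(Config E, ℝ), Tendsto (fun n => ∫ ω, f ω ∂(ν n)) atTop (𝓝 (∫ ω, f ω ∂μ))

/-- `μ` is the free random cluster measure: the limit of the finite-volume random cluster measures
along every exhaustion. -/
def IsFreeRC {V : Type*} (E : Set (Sym2 V)) (p q : ℝ) (μ : ProbabilityMeasure (Config E)) :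
    Prop :=
  ∀ Λ : ℕ → Finset V, IsExhaustion Λ → WeakLimit (fun n => freeVolume E (Λ n) p q) μ

/-- `μ` is the wired random cluster measure: the limit of the finite-volume random cluster
measures with wired boundary along every exhaustion. -/
def IsWiredRC {V : Type*} (E : Set (Sym2 V)) (p q : ℝ) (μ : ProbabilityMeasure (Config E)) :
    Prop :=
  ∀ Λ : ℕ → Finset V, IsExhaustion Λ → WeakLimit (fun n => wiredVolume E (Λ n) p q) μ

/-- The tail sigma-field: events that, for every finite set `K` of edges, are determined by the
states of the edges outside `K`. -/
@[reducible] def tail {V : Type*} (E : Set (Sym2 V)) : MeasurableSpace (Config E) :=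
  ⨅ K : Finset E, cylinderEvents ((K : Set E)ᶜ)

/-- All tail events have probability `0` or `1`. -/
def TailTrivial {V : Type*} {E : Set (Sym2 V)} (μ : Measure (Config E)) : Prop :=
  ∀ A : Set (Config E), MeasurableSet[tail E] A → μ A = 0 ∨ μ A = 1

section Automorphisms

variable {V : Type*} (E : Set (Sym2 V))

/-- The automorphism group: bijections of `V` that induce a bijection of `E`. -/
def graphAut : Subgroup (Equiv.Perm V) where
  carrier := {g | ∀ e : Sym2 V, e.map g ∈ E ↔ e ∈ E}
  one_mem' := by intro e; simp
  mul_mem' := by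
    intro a b ha hb e
    have : e.map (a * b) = (e.map b).map a := by simp [Sym2.map_map, Equiv.Perm.coe_mul]
    rw [this, ha, hb]
  inv_mem' := by
    intro a ha e
    rw [← ha (e.map (a⁻¹ : Equiv.Perm V))]
    have : (e.map (a⁻¹ : Equiv.Perm V)).map a = e := by
      rw [Sym2.map_map, ← Equiv.Perm.coe_mul]; simp
    rw [this]

/-- Automorphisms act on edges. -/
instance : MulAction (graphAut E) E where
  smul g e := ⟨(e : Sym2 V).map (g : Equiv.Perm V), (g.2 _).2 e.2⟩
  one_smul e := by
    apply Subtype.ext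
    change (e : Sym2 V).map ((1 : Equiv.Perm V)) = e
    simp
  mul_smul a b e := by
    apply Subtype.ext
    change (e : Sym2 V).map ((a : Equiv.Perm V) * (b : Equiv.Perm V)) =
      ((e : Sym2 V).map (b : Equiv.Perm V)).map (a : Equiv.Perm V)
    simp [Sym2.map_map, Equiv.Perm.coe_mul]

/-- Automorphisms act on configurations by moving the edges. -/
instance : MulAction (graphAut E) (Config E) where
  smul g ω := fun e => ω (g⁻¹ • e)
  one_smul ω := by
    funext e
    change ω ((1 : graphAut E)⁻¹ • e) = ω e
    simp
  mul_smul a b ω := by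
    funext e
    change ω ((a * b)⁻¹ • e) = ω (b⁻¹ • (a⁻¹ • e))
    rw [mul_inv_rev, mul_smul]

end Automorphisms

end RandomCluster

/-!
Both limits come from one monotonicity inequality between finite volumes. Let `F` be the edges
induced by `Λ`, let `Λ ⊆ Λ'`, let `K ⊆ F` and let `B` be an event determined by the edges outside
`F`. For the free measures, `ν_Λ (K open) * ν_Λ' B ≤ ν_Λ' (K open, B)`: whatever happens outside
`F`, the free boundary condition on `Λ` is the least favourable one for open edges. For the wired
measures the same holds with "closed" in place of "open". `IsMonotoneFamily` records this inequality
for both families.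

The inequality is proved with the four functions theorem on finite sets of edges
(`HasRCLaw.mul_le_of_free`, `HasRCLaw.mul_le_of_wired`). The number of components of a finite
multigraph is the number of vertices minus the dimension, over the field with two elements, of the
span of the vectors `δ_x + δ_y` over the open edges `xy`
(`card_connectedComponent_add_finrank_edgeSpan`). Identifying vertices is a linear map, so the
lattice condition, also between different boundary conditions, is the submodularity of dimension
(`finrank_inf_add_finrank_map_sup_le`, `weight_mul_weight_le`); this is where `1 ≤ q` enters. With
the rank in place of the number of components, the weight depends on the volume only through the
set of identified vertices. In the wired case this set is taken to be the internal boundary together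
with the complement of the volume, so that it decreases as the volume grows and every edge outside
the volume becomes a loop.

With `B` the sure event, the probabilities that all edges of `K` are open (closed) are monotone in
the volume. They determine a measure, and the space of probability measures on a compact space is
compact, so the family converges along the directed set of all finite volumes, hence along every
exhaustion (`IsMonotoneFamily.exists_tendsto`). The limit `μ` inherits the inequality; applied to
`B` and to its complement it bounds `|μ (A ∩ B) - μ A * μ B|`, for `A` the event that `K` is open
(closed), by `μ A - ν_Λ A`, which is small for large `Λ`, uniformly in `B`
(`IsMonotoneFamily.isDecorrelated`). This decorrelation passes to all events `A`. If `A` is a tail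
event, take `B = A`. If `A` is invariant, take for `B` the image of a cylinder event close to `A`
under an automorphism that moves its edges far away; one exists because some orbit is infinite and
balls are finite. Invariance holds because automorphisms permute the finite volumes.
-/

open MeasureTheory Filter Topology

namespace RandomCluster

/-! ### Cylinder events and weak convergence on `ι → Bool` -/

section Cylinders

variable {ι : Type*}

/-- The event that every coordinate in `K` equals `s`. -/
def agreeOn (s : Bool) (K : Finset ι) : Set (ι → Bool) := {ω | ∀ e ∈ K, ω e = s}

open Classical in
/-- The configuration `ω` with the coordinates in `F` set to `false`.  The events of the form
`closeOff F ⁻¹' B` are those determined by the coordinates outside `F`. -/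
noncomputable def closeOff (F : Finset ι) (ω : ι → Bool) : ι → Bool :=
  fun e => if e ∈ F then false else ω e

theorem continuous_closeOff (F : Finset ι) : Continuous (closeOff F) := by
  refine continuous_pi fun e => ?_
  by_cases h : e ∈ F
  · simpa [closeOff, h] using continuous_const
  · simpa [closeOff, h] using continuous_apply e

theorem measurable_closeOff (F : Finset ι) : Measurable (closeOff F) := by
  refine measurable_pi_lambda _ fun e => ?_
  by_cases h : e ∈ F
  · simp [closeOff, h]
  · simpa [closeOff, h] using measurable_pi_apply e

theorem isClopen_agreeOn (s : Bool) (K : Finset ι) : IsClopen (agreeOn s K) := by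
  have : agreeOn s K = ⋂ e ∈ K, (fun ω : ι → Bool => ω e) ⁻¹' {s} := by
    ext ω; simp [agreeOn]
  rw [this]
  exact isClopen_biInter_finset fun e _ => (isClopen_discrete _).preimage (continuous_apply e)

theorem measurableSet_agreeOn (s : Bool) (K : Finset ι) : MeasurableSet (agreeOn s K) := by
  have : agreeOn s K = ⋂ e ∈ K, (fun ω : ι → Bool => ω e) ⁻¹' {s} := by
    ext ω; simp [agreeOn]
  rw [this]
  exact K.measurableSet_biInter fun e _ => measurable_pi_apply e (measurableSet_singleton s)

theorem isPiSystem_agreeOn (s : Bool) : IsPiSystem (Set.range (agreeOn (ι := ι) s)) := by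
  classical
  rintro _ ⟨K, rfl⟩ _ ⟨K', rfl⟩ -
  refine ⟨K ∪ K', ?_⟩
  ext ω
  simp only [agreeOn, Finset.mem_union, Set.mem_ofPred_eq, Set.mem_inter_iff]
  exact ⟨fun h => ⟨fun e he => h e (.inl he), fun e he => h e (.inr he)⟩,
    fun h e he => he.elim (h.1 e) (h.2 e)⟩

theorem generateFrom_agreeOn (s : Bool) :
    (MeasurableSpace.pi : MeasurableSpace (ι → Bool)) =
      MeasurableSpace.generateFrom (Set.range (agreeOn s)) := by
  refine le_antisymm (iSup_le fun e => ?_) (MeasurableSpace.generateFrom_le ?_)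
  · rw [← measurable_iff_comap_le]
    have hs : MeasurableSet[MeasurableSpace.generateFrom (Set.range (agreeOn (ι := ι) s))]
        ((fun ω : ι → Bool => ω e) ⁻¹' {s}) :=
      MeasurableSpace.measurableSet_generateFrom ⟨{e}, by ext ω; simp [agreeOn]⟩
    refine @measurable_to_bool _ (_) _ ?_
    cases s
    · have : (fun ω : ι → Bool => ω e) ⁻¹' {true} = ((fun ω : ι → Bool => ω e) ⁻¹' {false})ᶜ := by
        ext ω; simp
      rw [this]; exact hs.compl
    · exact hs
  · rintro _ ⟨K, rfl⟩; exact measurableSet_agreeOn s K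

theorem isClopen_of_mem_measurableCylinders {C : Set (ι → Bool)}
    (hC : C ∈ measurableCylinders fun _ : ι => Bool) : IsClopen C := by
  obtain ⟨K, S, -, rfl⟩ := (mem_measurableCylinders _).1 hC
  exact (isClopen_discrete S).preimage (by fun_prop)

theorem measure_ext_of_agreeOn (s : Bool) {μ ν : Measure (ι → Bool)} [IsProbabilityMeasure μ]
    [IsProbabilityMeasure ν] (h : ∀ K, μ.real (agreeOn s K) = ν.real (agreeOn s K)) : μ = ν := by
  refine ext_of_generate_finite _ (generateFrom_agreeOn s) (isPiSystem_agreeOn s) ?_ (by simp)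
  rintro _ ⟨K, rfl⟩
  exact (ENNReal.toReal_eq_toReal_iff' (by finiteness) (by finiteness)).1 (h K)

/-- Events determined by the coordinates outside `F` do not see the coordinates in `F`. -/
theorem preimage_closeOff_of_measurableSet {F : Finset ι} {B : Set (ι → Bool)}
    (hB : MeasurableSet[cylinderEvents ((F : Set ι)ᶜ)] B) : closeOff F ⁻¹' B = B := by
  have hle : cylinderEvents (X := fun _ : ι => Bool) ((F : Set ι)ᶜ) ≤
      MeasurableSpace.comap (closeOff F) MeasurableSpace.pi := by
    refine iSup₂_le fun e he => ?_
    rw [← measurable_iff_comap_le]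
    have : (fun ω : ι → Bool => ω e) = (fun ω : ι → Bool => ω e) ∘ closeOff F := by
      funext ω
      have he' : e ∉ F := he
      simp [closeOff, he']
    rw [this]
    exact (measurable_pi_apply e).comp (comap_measurable _)
  obtain ⟨B', -, rfl⟩ := hle _ hB
  have hid : closeOff F ∘ closeOff F = closeOff F := by
    funext ω e; simp [closeOff]
  rw [← Set.preimage_comp, hid]

variable [Countable ι]

theorem tendsto_measureReal_of_isClopen {D : Type*} {l : Filter D}
    {ν : D → ProbabilityMeasure (ι → Bool)} {μ : ProbabilityMeasure (ι → Bool)}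
    (h : Tendsto ν l (𝓝 μ)) {C : Set (ι → Bool)} (hC : IsClopen C) :
    Tendsto (fun d => (ν d : Measure (ι → Bool)).real C) l
      (𝓝 ((μ : Measure (ι → Bool)).real C)) := by
  have := ProbabilityMeasure.tendsto_measure_of_null_frontier_of_tendsto' h (E := C)
    (by simp [hC.frontier_eq])
  exact (ENNReal.tendsto_toReal (measure_ne_top _ _)).comp this

/-- Weak convergence follows from convergence of the probabilities of the events `agreeOn s K`. -/
theorem exists_tendsto_of_agreeOn (s : Bool) {D : Type*} {l : Filter D} [l.NeBot]
    {ν : D → ProbabilityMeasure (ι → Bool)}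
    (h : ∀ K, ∃ c, Tendsto (fun d => (ν d : Measure (ι → Bool)).real (agreeOn s K)) l (𝓝 c)) :
    ∃ μ, Tendsto ν l (𝓝 μ) := by
  choose c hc using h
  have key : ∀ μ, MapClusterPt μ l ν → ∀ K, (μ : Measure (ι → Bool)).real (agreeOn s K) = c K := by
    intro μ hμ K
    have hcont : Tendsto (fun μ : ProbabilityMeasure (ι → Bool) =>
        (μ : Measure (ι → Bool)).real (agreeOn s K)) (𝓝 μ)
        (𝓝 ((μ : Measure (ι → Bool)).real (agreeOn s K))) :=
      tendsto_measureReal_of_isClopen tendsto_id (isClopen_agreeOn s K)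
    have h1 : MapClusterPt _ l _ := hμ.tendsto_comp hcont
    have h2 : (𝓝 ((μ : Measure (ι → Bool)).real (agreeOn s K)) ⊓ 𝓝 (c K)).NeBot :=
      Filter.NeBot.mono h1 (inf_le_inf_left _ (hc K))
    exact eq_of_nhds_neBot h2
  obtain ⟨μ, -, hμ⟩ := IsCompact.exists_mapClusterPt
    (isCompact_univ (X := ProbabilityMeasure (ι → Bool))) (u := ν) (f := l) (by simp)
  refine ⟨μ, isCompact_univ.tendsto_nhds_of_unique_mapClusterPt (by simp) fun μ' _ hμ' => ?_⟩
  have hext : (μ' : Measure (ι → Bool)) = μ :=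
    measure_ext_of_agreeOn s fun K => (key μ' hμ' K).trans (key μ hμ K).symm
  exact Subtype.ext hext

end Cylinders

/-! ### Decorrelation from far away coordinates -/

section Decorrelation

variable {ι : Type*}

/-- `A` is asymptotically independent under `μ`, uniformly, of the events determined by the
coordinates outside a large finite set. -/
def IsDecorrelated (μ : Measure (ι → Bool)) (A : Set (ι → Bool)) : Prop :=
  ∀ ε > 0, ∃ F : Finset ι, ∀ B, MeasurableSet B →
    |μ.real (A ∩ closeOff F ⁻¹' B) - μ.real A * μ.real (closeOff F ⁻¹' B)| ≤ ε

theorem closeOff_comp_closeOff {F F' : Finset ι} (h : F ⊆ F') :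
    closeOff F' ∘ closeOff F = closeOff F' := by
  funext ω e
  by_cases he : e ∈ F'
  · simp [closeOff, he]
  · have : e ∉ F := fun h' => he (h h')
    simp [closeOff, he, this]

theorem IsDecorrelated.empty {μ : Measure (ι → Bool)} : IsDecorrelated μ ∅ :=
  fun ε hε => ⟨∅, fun B _ => by simpa using hε.le⟩

variable {μ : Measure (ι → Bool)} [IsProbabilityMeasure μ]

theorem IsDecorrelated.of_approx {A : Set (ι → Bool)} (hA : MeasurableSet A)
    (h : ∀ ε > 0, ∃ A', MeasurableSet A' ∧ IsDecorrelated μ A' ∧ μ.real (symmDiff A A') ≤ ε) :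
    IsDecorrelated μ A := by
  intro ε hε
  obtain ⟨A', hA', hdec, hAA'⟩ := h (ε / 3) (by positivity)
  obtain ⟨F, hF⟩ := hdec (ε / 3) (by positivity)
  refine ⟨F, fun B hB => ?_⟩
  have hB' := measurable_closeOff F hB
  set C := closeOff F ⁻¹' B
  have h1 : |μ.real (A ∩ C) - μ.real (A' ∩ C)| ≤ ε / 3 := by
    refine (abs_measureReal_sub_le_measureReal_symmDiff (hA.inter hB').nullMeasurableSet
      (hA'.inter hB').nullMeasurableSet).trans ((measureReal_mono ?_).trans hAA')
    rw [← Set.inter_symmDiff_distrib_right]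
    exact Set.inter_subset_left
  have h2 : |μ.real A - μ.real A'| ≤ ε / 3 :=
    (abs_measureReal_sub_le_measureReal_symmDiff hA.nullMeasurableSet
      hA'.nullMeasurableSet).trans hAA'
  have h3 := hF B hB
  have h4 : |(μ.real A - μ.real A') * μ.real C| ≤ ε / 3 := by
    rw [abs_mul, abs_of_nonneg (measureReal_nonneg (s := C))]
    exact (mul_le_of_le_one_right (abs_nonneg _) measureReal_le_one).trans h2
  rw [abs_le] at *
  constructor <;> nlinarith

theorem IsDecorrelated.compl {A : Set (ι → Bool)} (hA : MeasurableSet A)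
    (h : IsDecorrelated μ A) : IsDecorrelated μ Aᶜ := by
  intro ε hε
  obtain ⟨F, hF⟩ := h ε hε
  refine ⟨F, fun B hB => ?_⟩
  have h1 := hF B hB
  set C := closeOff F ⁻¹' B
  have h2 : μ.real (Aᶜ ∩ C) = μ.real C - μ.real (A ∩ C) := by
    rw [eq_sub_iff_add_eq, add_comm, Set.inter_comm A, Set.inter_comm Aᶜ]
    exact measureReal_inter_add_sdiff hA
  rw [h2, probReal_compl_eq_one_sub hA, ← abs_neg]
  convert h1 using 2
  ring

theorem IsDecorrelated.union {A A' : Set (ι → Bool)} (hA' : MeasurableSet A')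
    (hd : Disjoint A A') (h : IsDecorrelated μ A) (h' : IsDecorrelated μ A') :
    IsDecorrelated μ (A ∪ A') := by
  classical
  intro ε hε
  obtain ⟨F, hF⟩ := h (ε / 2) (by positivity)
  obtain ⟨F', hF'⟩ := h' (ε / 2) (by positivity)
  refine ⟨F ∪ F', fun B hB => ?_⟩
  have hB' := measurable_closeOff (F ∪ F') hB
  have h1 := hF _ hB'
  have h2 := hF' _ hB'
  rw [← Set.preimage_comp, closeOff_comp_closeOff Finset.subset_union_left] at h1
  rw [← Set.preimage_comp, closeOff_comp_closeOff Finset.subset_union_right] at h2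
  set C := closeOff (F ∪ F') ⁻¹' B
  have h3 : μ.real ((A ∪ A') ∩ C) = μ.real (A ∩ C) + μ.real (A' ∩ C) := by
    rw [Set.union_inter_distrib_right]
    exact measureReal_union (hd.mono Set.inter_subset_left Set.inter_subset_left) (hA'.inter hB')
  rw [h3, measureReal_union hd hA']
  rw [abs_le] at *
  constructor <;> nlinarith

/-- Decorrelation of the events `agreeOn s K` passes to all measurable events. -/
theorem isDecorrelated_of_agreeOn (s : Bool) (h : ∀ K, IsDecorrelated μ (agreeOn s K))
    {A : Set (ι → Bool)} (hA : MeasurableSet A) : IsDecorrelated μ A := by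
  refine MeasurableSpace.induction_on_inter (C := fun A _ => IsDecorrelated μ A)
    (generateFrom_agreeOn s) (isPiSystem_agreeOn s) .empty ?_ (fun t ht h => h.compl ht) ?_ A hA
  · rintro _ ⟨K, rfl⟩; exact h K
  · intro f hd hf hdec
    have hfin : ∀ n, IsDecorrelated μ (⋃ i ∈ Finset.range n, f i) := by
      intro n
      induction n with
      | zero => simpa using IsDecorrelated.empty
      | succ n ih =>
        rw [Finset.range_add_one, Finset.set_biUnion_insert, Set.union_comm]
        refine ih.union (hf n) ?_ (hdec n)
        simp only [Set.disjoint_iUnion_left]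
        exact fun i hi => hd (Finset.mem_range.1 hi).ne
    have hm : ∀ n, MeasurableSet (⋃ i ∈ Finset.range n, f i) := fun n =>
      Finset.measurableSet_biUnion _ fun i _ => hf i
    refine .of_approx (MeasurableSet.iUnion hf) fun ε hε => ?_
    have hlim : Tendsto (fun n => μ.real (⋃ i ∈ Finset.range n, f i)) atTop
        (𝓝 (μ.real (⋃ i, f i))) := by
      have hmono : Monotone fun n => ⋃ i ∈ Finset.range n, f i := fun a b hab =>
        Set.biUnion_subset_biUnion_left fun i hi => by simp at hi ⊢; omega
      have := tendsto_measure_iUnion_atTop (μ := μ) hmono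
      have hU : ⋃ n, ⋃ i ∈ Finset.range n, f i = ⋃ i, f i := by
        ext x; simp only [Set.mem_iUnion, Finset.mem_range]
        exact ⟨fun ⟨_, i, _, hi⟩ => ⟨i, hi⟩, fun ⟨i, hi⟩ => ⟨i + 1, i, by omega, hi⟩⟩
      rw [hU] at this
      exact (ENNReal.tendsto_toReal (measure_ne_top _ _)).comp this
    obtain ⟨n, hn⟩ := (hlim.eventually (lt_mem_nhds (sub_lt_self _ hε))).exists
    refine ⟨_, hm n, hfin n, ?_⟩
    have hsub : ⋃ i ∈ Finset.range n, f i ⊆ ⋃ i, f i :=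
      Set.iUnion₂_subset fun i _ => Set.subset_iUnion f i
    rw [Set.symmDiff_def, Set.sdiff_eq_empty.2 hsub, Set.union_empty,
      measureReal_sdiff hsub (hm n)]
    linarith

theorem measure_eq_zero_or_one_of_forall_abs_le {A : Set (ι → Bool)}
    (h : ∀ ε > 0, |μ.real A - μ.real A * μ.real A| ≤ ε) : μ A = 0 ∨ μ A = 1 := by
  have h0 : |μ.real A - μ.real A * μ.real A| ≤ 0 := le_of_forall_pos_le_add fun ε hε => by
    simpa using h ε hε
  have h1 : μ.real A * (1 - μ.real A) = 0 := by
    rw [mul_sub, mul_one]; exact abs_nonpos_iff.1 h0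
  rcases mul_eq_zero.1 h1 with h2 | h2
  · exact .inl ((measureReal_eq_zero_iff (by finiteness)).1 h2)
  · exact .inr ((ENNReal.toReal_eq_one_iff _).1 (show μ.real A = 1 by linarith))

/-- A decorrelated measure gives every tail event probability `0` or `1`. -/
theorem measure_tail_eq_zero_or_one (h : ∀ A, MeasurableSet A → IsDecorrelated μ A)
    {A : Set (ι → Bool)} (hA : ∀ F : Finset ι, MeasurableSet[cylinderEvents ((F : Set ι)ᶜ)] A) :
    μ A = 0 ∨ μ A = 1 := by
  have hAm : MeasurableSet A := cylinderEvents_le_pi _ (hA ∅)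
  refine measure_eq_zero_or_one_of_forall_abs_le fun ε hε => ?_
  obtain ⟨F, hF⟩ := h A hAm ε hε
  simpa [preimage_closeOff_of_measurableSet (hA F)] using hF A hAm

/-- An event that is invariant, up to null sets, under coordinate relabellings that move any finite
set off any other has probability `0` or `1` for a decorrelated measure. -/
theorem measure_invariant_eq_zero_or_one (h : ∀ A, MeasurableSet A → IsDecorrelated μ A)
    {A : Set (ι → Bool)} (hA : MeasurableSet A)
    (hT : ∀ K F : Finset ι, ∃ σ : ι → ι, MeasurePreserving (fun ω : ι → Bool => ω ∘ σ) μ μ ∧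
      (fun ω : ι → Bool => ω ∘ σ) ⁻¹' A =ᵐ[μ] A ∧ ∀ e ∈ K, σ e ∉ F) :
    μ A = 0 ∨ μ A = 1 := by
  refine measure_eq_zero_or_one_of_forall_abs_le fun ε hε => ?_
  obtain ⟨F, hF⟩ := h A hA (ε / 3) (by positivity)
  have hdense := Measure.MeasureDense.of_generateFrom_isSetAlgebra_finite μ
    (isSetAlgebra_measurableCylinders (α := fun _ : ι => Bool))
    generateFrom_measurableCylinders.symm
  obtain ⟨C, hC, hAC⟩ := hdense.approx A hA (measure_ne_top _ _) (ε / 3) (by positivity)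
  have hCm : MeasurableSet C := hdense.measurable C hC
  have hAC' : μ.real (symmDiff A C) ≤ ε / 3 := ENNReal.toReal_le_of_le_ofReal (by positivity) hAC.le
  obtain ⟨K, S, -, rfl⟩ := (mem_measurableCylinders _).1 hC
  obtain ⟨σ, hσ, hσA, hσK⟩ := hT K F
  set T : (ι → Bool) → (ι → Bool) := fun ω => ω ∘ σ
  have hcyl : closeOff F ⁻¹' (T ⁻¹' cylinder K S) = T ⁻¹' cylinder K S := by
    ext ω
    simp only [Set.mem_preimage, mem_cylinder]
    have : K.restrict (T (closeOff F ω)) = K.restrict (T ω) := by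
      funext e
      simp [T, closeOff, hσK e e.2]
    rw [this]
  have hdec := hF _ (hσ.measurable hCm)
  rw [hcyl] at hdec
  have hTm : MeasurableSet (T ⁻¹' cylinder K S) := hσ.measurable hCm
  have hsd : μ.real (symmDiff A (T ⁻¹' cylinder K S)) ≤ ε / 3 := by
    have h1 : μ.real (symmDiff A (T ⁻¹' cylinder K S)) =
        μ.real (T ⁻¹' (symmDiff A (cylinder K S))) := by
      refine measureReal_congr ?_
      rw [Set.preimage_symmDiff]
      exact (hσA.symm.symmDiff (ae_eq_refl _))
    rw [h1, hσ.measureReal_preimage (hA.symmDiff hCm).nullMeasurableSet]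
    exact hAC'
  have e1 := (abs_measureReal_sub_le_measureReal_symmDiff hA.nullMeasurableSet
    hTm.nullMeasurableSet).trans hsd
  have e2 : |μ.real A - μ.real (A ∩ T ⁻¹' cylinder K S)| ≤ ε / 3 := by
    refine (abs_measureReal_sub_le_measureReal_symmDiff hA.nullMeasurableSet
      (hA.inter hTm).nullMeasurableSet).trans ((measureReal_mono ?_).trans hsd)
    rintro ω (⟨h1, h2⟩ | ⟨h1, h2⟩)
    · exact .inl ⟨h1, fun h3 => h2 ⟨h1, h3⟩⟩
    · exact absurd h1.1 h2
  have e3 : |μ.real A * (μ.real A - μ.real (T ⁻¹' cylinder K S))| ≤ ε / 3 := by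
    rw [abs_mul, abs_of_nonneg (measureReal_nonneg (s := A))]
    exact (mul_le_of_le_one_left (abs_nonneg _) measureReal_le_one).trans e1
  rw [abs_le] at *
  constructor <;> nlinarith

end Decorrelation

/-! ### Monotone families of finite-volume measures -/

section MonotoneFamily

variable {ι D : Type*} [Preorder D]

/-- Measures `ν d` living on the finite coordinate sets `F d` such that, in volume `d'`, whatever
happens outside `F d` only helps the events `agreeOn s K`, `K ⊆ F d`, compared to volume `d`. -/
structure IsMonotoneFamily (s : Bool) (F : D → Finset ι) (ν : D → ProbabilityMeasure (ι → Bool)) :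
    Prop where
  mono : Monotone F
  exhausts : ∀ K, ∃ d, K ⊆ F d
  mul_le : ∀ d d', d ≤ d' → ∀ K ⊆ F d, ∀ B, MeasurableSet B →
    (ν d : Measure (ι → Bool)).real (agreeOn s K) *
        (ν d' : Measure (ι → Bool)).real (closeOff (F d) ⁻¹' B) ≤
      (ν d' : Measure (ι → Bool)).real (agreeOn s K ∩ closeOff (F d) ⁻¹' B)

variable [IsDirectedOrder D] [Countable ι] {s : Bool} {F : D → Finset ι}
  {ν : D → ProbabilityMeasure (ι → Bool)} {μ : ProbabilityMeasure (ι → Bool)}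

theorem IsMonotoneFamily.exists_tendsto [Nonempty D] (h : IsMonotoneFamily s F ν) :
    ∃ μ, Tendsto ν atTop (𝓝 μ) := by
  refine exists_tendsto_of_agreeOn s fun K => ?_
  obtain ⟨d₀, hd₀⟩ := h.exhausts K
  -- The probabilities increase once the volume contains `K`.
  have hmono : Monotone fun d : Set.Ici d₀ => (ν d : Measure (ι → Bool)).real (agreeOn s K) := by
    intro d d' hdd'
    simpa using h.mul_le d d' hdd' K (hd₀.trans (h.mono d.2)) Set.univ .univ
  have hlim := tendsto_atTop_ciSup hmono
    ⟨1, by rintro _ ⟨d, rfl⟩; exact measureReal_le_one⟩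
  exact ⟨_, (tendsto_comp_val_Ici_atTop
    (f := fun d => (ν d : Measure (ι → Bool)).real (agreeOn s K))).1 hlim⟩

variable [Nonempty D]

theorem IsMonotoneFamily.mul_le_limit (h : IsMonotoneFamily s F ν) (hμ : Tendsto ν atTop (𝓝 μ))
    (d : D) {K : Finset ι} (hK : K ⊆ F d) {B : Set (ι → Bool)} (hB : MeasurableSet B) :
    (ν d : Measure (ι → Bool)).real (agreeOn s K) *
        (μ : Measure (ι → Bool)).real (closeOff (F d) ⁻¹' B) ≤
      (μ : Measure (ι → Bool)).real (agreeOn s K ∩ closeOff (F d) ⁻¹' B) := by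
  have hclopen : ∀ C : Set (ι → Bool), IsClopen C →
      (ν d : Measure (ι → Bool)).real (agreeOn s K) *
        (μ : Measure (ι → Bool)).real (closeOff (F d) ⁻¹' C) ≤
      (μ : Measure (ι → Bool)).real (agreeOn s K ∩ closeOff (F d) ⁻¹' C) := by
    intro C hC
    have hC' : IsClopen (closeOff (F d) ⁻¹' C) := hC.preimage (continuous_closeOff _)
    refine le_of_tendsto_of_tendsto ((tendsto_measureReal_of_isClopen hμ hC').const_mul _)
      (tendsto_measureReal_of_isClopen hμ ((isClopen_agreeOn s K).inter hC')) ?_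
    filter_upwards [eventually_ge_atTop d] with d' hd'
    exact h.mul_le d d' hd' K hK C hC.2.measurableSet
  have hm := measurable_closeOff (F d)
  have hdense := Measure.MeasureDense.of_generateFrom_isSetAlgebra_finite
    ((μ : Measure (ι → Bool)).map (closeOff (F d)))
    (isSetAlgebra_measurableCylinders (α := fun _ : ι => Bool))
    generateFrom_measurableCylinders.symm
  refine le_of_forall_pos_le_add fun ε hε => ?_
  obtain ⟨C, hC, hBC⟩ := hdense.approx B hB (measure_ne_top _ _) (ε / 2) (by positivity)
  have hCm : MeasurableSet C := hdense.measurable C hC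
  rw [Measure.map_apply hm (hB.symmDiff hCm), Set.preimage_symmDiff] at hBC
  have hBC' : (μ : Measure (ι → Bool)).real
      (symmDiff (closeOff (F d) ⁻¹' B) (closeOff (F d) ⁻¹' C)) ≤ ε / 2 :=
    ENNReal.toReal_le_of_le_ofReal (by positivity) hBC.le
  have h1 := (abs_measureReal_sub_le_measureReal_symmDiff (hm hB).nullMeasurableSet
    (hm hCm).nullMeasurableSet).trans hBC'
  have h2 : |(μ : Measure (ι → Bool)).real (agreeOn s K ∩ closeOff (F d) ⁻¹' B) -
      (μ : Measure (ι → Bool)).real (agreeOn s K ∩ closeOff (F d) ⁻¹' C)| ≤ ε / 2 := by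
    have hK' := measurableSet_agreeOn s K
    refine (abs_measureReal_sub_le_measureReal_symmDiff (hK'.inter (hm hB)).nullMeasurableSet
      (hK'.inter (hm hCm)).nullMeasurableSet).trans ((measureReal_mono ?_).trans hBC')
    rw [← Set.inter_symmDiff_distrib_left]
    exact Set.inter_subset_right
  have h3 := hclopen C (isClopen_of_mem_measurableCylinders hC)
  have h4 : |(ν d : Measure (ι → Bool)).real (agreeOn s K) *
      ((μ : Measure (ι → Bool)).real (closeOff (F d) ⁻¹' B) -
        (μ : Measure (ι → Bool)).real (closeOff (F d) ⁻¹' C))| ≤ ε / 2 := by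
    rw [abs_mul, abs_of_nonneg measureReal_nonneg]
    exact (mul_le_of_le_one_left (abs_nonneg _) measureReal_le_one).trans h1
  rw [abs_le] at h2 h4
  nlinarith

/-- Applying the comparison to `B` and to its complement controls the correlation by the
finite-volume error `μ (agreeOn s K) - ν d (agreeOn s K)`. -/
theorem IsMonotoneFamily.isDecorrelated (h : IsMonotoneFamily s F ν) (hμ : Tendsto ν atTop (𝓝 μ))
    {A : Set (ι → Bool)} (hA : MeasurableSet A) : IsDecorrelated (μ : Measure (ι → Bool)) A := by
  refine isDecorrelated_of_agreeOn s (fun K ε hε => ?_) hA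
  obtain ⟨d₀, hd₀⟩ := h.exhausts K
  have hlim := tendsto_measureReal_of_isClopen hμ (isClopen_agreeOn s K)
  obtain ⟨d, hd, hdε⟩ := ((eventually_ge_atTop d₀).and
    (hlim.eventually (lt_mem_nhds (sub_lt_self _ hε)))).exists
  have hK : K ⊆ F d := hd₀.trans (h.mono hd)
  refine ⟨F d, fun B hB => ?_⟩
  have h1 := h.mul_le_limit hμ d hK hB
  have h2 := h.mul_le_limit hμ d hK hB.compl
  have hm := measurable_closeOff (F d) hB
  rw [Set.preimage_compl] at h2
  set C := closeOff (F d) ⁻¹' B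
  rw [probReal_compl_eq_one_sub hm] at h2
  have h3 : (μ : Measure (ι → Bool)).real (agreeOn s K ∩ C) +
      (μ : Measure (ι → Bool)).real (agreeOn s K ∩ Cᶜ) =
      (μ : Measure (ι → Bool)).real (agreeOn s K) := measureReal_inter_add_sdiff hm
  have h4 : 0 ≤ (μ : Measure (ι → Bool)).real C := measureReal_nonneg
  have h5 : (μ : Measure (ι → Bool)).real C ≤ 1 := measureReal_le_one
  rw [abs_le]
  constructor <;> nlinarith

end MonotoneFamily

/-! ### The graphic rank function -/

section Rank

variable {U U' : Type*}

/-- The vector `δ_x + δ_y` over the field with two elements attached to the edge `xy`. -/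
noncomputable def edgeVec : Sym2 U → (U →₀ ZMod 2) :=
  Sym2.lift ⟨fun x y => Finsupp.single x 1 + Finsupp.single y 1, fun _ _ => add_comm _ _⟩

@[simp] theorem edgeVec_mk (x y : U) :
    edgeVec s(x, y) = Finsupp.single x 1 + Finsupp.single y 1 := rfl

/-- The span of the edge vectors of a set of edges; its dimension is the graphic rank. -/
noncomputable def edgeSpan (S : Set (Sym2 U)) : Submodule (ZMod 2) (U →₀ ZMod 2) :=
  Submodule.span (ZMod 2) (edgeVec '' S)

theorem mapDomain_edgeVec (f : U → U') (e : Sym2 U) :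
    Finsupp.lmapDomain (ZMod 2) (ZMod 2) f (edgeVec e) = edgeVec (e.map f) := by
  induction e with | _ x y => simp [Finsupp.mapDomain_add, Finsupp.mapDomain_single]

theorem map_edgeSpan (f : U → U') (S : Set (Sym2 U)) :
    (edgeSpan S).map (Finsupp.lmapDomain (ZMod 2) (ZMod 2) f) = edgeSpan (Sym2.map f '' S) := by
  rw [edgeSpan, Submodule.map_span, edgeSpan, Set.image_image, Set.image_image]
  simp_rw [mapDomain_edgeVec]

theorem edgeVec_of_isDiag {e : Sym2 U} (h : e.IsDiag) : edgeVec e = 0 := by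
  induction e with | _ x y =>
    obtain rfl : x = y := by simpa using h
    simp only [edgeVec_mk, ← Finsupp.single_add]
    simp [CharTwo.add_self_eq_zero]

theorem single_add_single_mem_of_reachable {S : Set (Sym2 U)} {x y : U}
    (h : (SimpleGraph.fromEdgeSet S).Reachable x y) :
    Finsupp.single x (1 : ZMod 2) + Finsupp.single y 1 ∈ edgeSpan S := by
  obtain ⟨w⟩ := h
  induction w with
  | nil => simp [← Finsupp.single_add, CharTwo.add_self_eq_zero]
  | @cons u v w huv _ ih =>
    have h1 : Finsupp.single u (1 : ZMod 2) + Finsupp.single v 1 ∈ edgeSpan S :=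
      Submodule.subset_span ⟨s(u, v), ((SimpleGraph.fromEdgeSet_adj _).1 huv).1, rfl⟩
    have h2 : Finsupp.single u (1 : ZMod 2) + Finsupp.single w 1 =
        (Finsupp.single u 1 + Finsupp.single v 1) + (Finsupp.single v 1 + Finsupp.single w 1) := by
      rw [add_assoc, ← add_assoc (Finsupp.single v (1 : ZMod 2)), ← Finsupp.single_add,
        CharTwo.add_self_eq_zero]
      simp
    rw [h2]
    exact add_mem h1 ih

/-- The vectors killed by collapsing every component to a point are the span of the edges. -/
theorem ker_mapDomain_connectedComponentMk (S : Set (Sym2 U)) :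
    LinearMap.ker (Finsupp.lmapDomain (ZMod 2) (ZMod 2)
      (SimpleGraph.fromEdgeSet S).connectedComponentMk) = edgeSpan S := by
  set G := SimpleGraph.fromEdgeSet S
  refine le_antisymm (fun v hv => ?_) ?_
  · -- `v` differs from its collapse onto chosen representatives by an element of the span.
    let r : U → U := fun x => (G.connectedComponentMk x).out
    have hr : Finsupp.mapDomain r v = 0 := by
      have : r = (fun c : G.ConnectedComponent => c.out) ∘ G.connectedComponentMk := rfl
      rw [this, Finsupp.mapDomain_comp]
      have hv' : Finsupp.mapDomain G.connectedComponentMk v = 0 := hv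
      rw [hv', Finsupp.mapDomain_zero]
    have key : ∀ v : U →₀ ZMod 2, v + Finsupp.mapDomain r v ∈ edgeSpan S := by
      intro v
      induction v using Finsupp.induction_linear with
      | zero => simp
      | add f g hf hg =>
        rw [Finsupp.mapDomain_add, add_add_add_comm]
        exact add_mem hf hg
      | single x a =>
        have h1 : G.Reachable x (r x) :=
          (SimpleGraph.ConnectedComponent.exact (Quot.out_eq (G.connectedComponentMk x))).symm
        have := (edgeSpan S).smul_mem a (single_add_single_mem_of_reachable h1)
        simpa [Finsupp.mapDomain_single] using this
    simpa [hr] using key v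
  · rw [edgeSpan, Submodule.span_le]
    rintro _ ⟨e, he, rfl⟩
    rw [SetLike.mem_coe, LinearMap.mem_ker, mapDomain_edgeVec]
    refine edgeVec_of_isDiag ?_
    induction e with | _ x y =>
      rw [Sym2.map_mk, Sym2.mk_isDiag_iff, SimpleGraph.ConnectedComponent.eq]
      by_cases hxy : x = y
      · exact hxy ▸ SimpleGraph.Reachable.refl _
      · exact SimpleGraph.Adj.reachable ((SimpleGraph.fromEdgeSet_adj _).2 ⟨he, hxy⟩)

theorem card_connectedComponent_add_finrank_edgeSpan [Finite U] (S : Set (Sym2 U)) :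
    Nat.card (SimpleGraph.fromEdgeSet S).ConnectedComponent +
      Module.finrank (ZMod 2) (edgeSpan S) = Nat.card U := by
  classical
  have := Fintype.ofFinite U
  have := Fintype.ofFinite (SimpleGraph.fromEdgeSet S).ConnectedComponent
  have h := LinearMap.finrank_range_add_finrank_ker (Finsupp.lmapDomain (ZMod 2) (ZMod 2)
      (SimpleGraph.fromEdgeSet S).connectedComponentMk)
  rw [ker_mapDomain_connectedComponentMk, LinearMap.range_eq_top.2
    (Finsupp.mapDomain_surjective Quot.mk_surjective)] at h
  simpa [Nat.card_eq_fintype_card] using h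

theorem finrank_edgeSpan_image {f : U → U'} (hf : Function.Injective f) (S : Set (Sym2 U)) :
    Module.finrank (ZMod 2) (edgeSpan (Sym2.map f '' S)) =
      Module.finrank (ZMod 2) (edgeSpan S) := by
  rw [← map_edgeSpan]
  exact (Submodule.equivMapOfInjective _ (Finsupp.mapDomain_injective hf) _).finrank_eq.symm

theorem finiteDimensional_edgeSpan {S : Set (Sym2 U)} (hS : S.Finite) :
    FiniteDimensional (ZMod 2) (edgeSpan S) :=
  FiniteDimensional.span_of_finite _ (hS.image _)

theorem finrank_map_add_finrank_inf_ker {k M M' : Type*} [Field k] [AddCommGroup M] [Module k M]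
    [AddCommGroup M'] [Module k M'] (L : M →ₗ[k] M') (A : Submodule k M) [FiniteDimensional k A] :
    Module.finrank k (A.map L) + Module.finrank k ↥(A ⊓ LinearMap.ker L) = Module.finrank k A := by
  rw [← LinearMap.finrank_range_add_finrank_ker (L.domRestrict A), LinearMap.range_domRestrict,
    LinearMap.ker_domRestrict, ← Submodule.finrank_map_subtype_eq A, Submodule.map_comap_subtype]

/-- Submodularity of dimension, relative to a linear map. -/
theorem finrank_inf_add_finrank_map_sup_le {k M M' : Type*} [Field k] [AddCommGroup M] [Module k M]
    [AddCommGroup M'] [Module k M'] (L : M →ₗ[k] M') (A B : Submodule k M)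
    [FiniteDimensional k A] [FiniteDimensional k B] :
    Module.finrank k ↥(A ⊓ B) + Module.finrank k ((A ⊔ B).map L) ≤
      Module.finrank k A + Module.finrank k (B.map L) := by
  have h1 := Submodule.finrank_sup_add_finrank_inf_eq A B
  have h2 := finrank_map_add_finrank_inf_ker L B
  have h3 := finrank_map_add_finrank_inf_ker L (A ⊔ B)
  have h4 : Module.finrank k ↥(B ⊓ LinearMap.ker L) ≤
      Module.finrank k ↥((A ⊔ B) ⊓ LinearMap.ker L) :=
    Submodule.finrank_mono (inf_le_inf_right _ le_sup_right)
  omega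

end Rank

/-! ### Random cluster weights on finite sets of edges -/

section Weights

variable {V : Type*} {E : Set (Sym2 V)}

open Classical in
/-- The map that identifies all vertices of `Q` to the single point `none`. -/
noncomputable def wireMap (Q : Set V) (x : V) : Option V := if x ∈ Q then none else some x

theorem wireMap_bind {Q Q' : Set V} (h : Q ⊆ Q') :
    (fun o : Option V => o.bind (wireMap Q')) ∘ wireMap Q = wireMap Q' := by
  funext x
  by_cases hx : x ∈ Q
  · simp [wireMap, hx, h hx]
  · simp [wireMap, hx]

/-- The images of the edges of `A` after the vertices of `Q` are identified. -/
def wiredImage (Q : Set V) (A : Finset E) : Set (Sym2 (Option V)) :=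
  (fun e : E => (e : Sym2 V).map (wireMap Q)) '' A

/-- The graphic rank of `A` after the vertices of `Q` are identified. -/
noncomputable def wiredRank (Q : Set V) (A : Finset E) : ℕ :=
  Module.finrank (ZMod 2) (edgeSpan (wiredImage Q A))

theorem finite_wiredImage (Q : Set V) (A : Finset E) : (wiredImage Q A).Finite :=
  A.finite_toSet.image _

theorem map_wiredImage {Q Q' : Set V} (h : Q ⊆ Q') (A : Finset E) :
    Sym2.map (fun o : Option V => o.bind (wireMap Q')) '' wiredImage Q A = wiredImage Q' A := by
  rw [wiredImage, Set.image_image, wiredImage]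
  simp_rw [Sym2.map_map, wireMap_bind h]

theorem edgeSpan_union {U : Type*} (S T : Set (Sym2 U)) :
    edgeSpan (S ∪ T) = edgeSpan S ⊔ edgeSpan T := by
  rw [edgeSpan, Set.image_union, Submodule.span_union]; rfl

theorem edgeSpan_mono {U : Type*} {S T : Set (Sym2 U)} (h : S ⊆ T) : edgeSpan S ≤ edgeSpan T :=
  Submodule.span_mono (Set.image_mono h)

open Classical in
/-- Submodularity of the rank.  Identifying more vertices only decreases the gain in rank from
adding edges. -/
theorem wiredRank_inter_add_wiredRank_union_le {Q Q' : Set V} (h : Q ⊆ Q') (A B : Finset E) :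
    wiredRank Q (A ∩ B) + wiredRank Q' (A ∪ B) ≤ wiredRank Q A + wiredRank Q' B := by
  have := finiteDimensional_edgeSpan (finite_wiredImage Q A)
  have := finiteDimensional_edgeSpan (finite_wiredImage Q B)
  have hle : edgeSpan (wiredImage Q (A ∩ B)) ≤
      edgeSpan (wiredImage Q A) ⊓ edgeSpan (wiredImage Q B) :=
    le_inf (edgeSpan_mono (Set.image_mono (by simp)))
      (edgeSpan_mono (Set.image_mono (by simp)))
  have hsup : edgeSpan (wiredImage Q (A ∪ B)) =
      edgeSpan (wiredImage Q A) ⊔ edgeSpan (wiredImage Q B) := by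
    rw [← edgeSpan_union, wiredImage, Finset.coe_union, Set.image_union]; rfl
  have key := finrank_inf_add_finrank_map_sup_le (Finsupp.lmapDomain (ZMod 2) (ZMod 2)
    (fun o : Option V => o.bind (wireMap Q'))) (edgeSpan (wiredImage Q A))
    (edgeSpan (wiredImage Q B))
  rw [← hsup, map_edgeSpan, map_edgeSpan, map_wiredImage h, map_wiredImage h] at key
  exact (Nat.add_le_add_right (Submodule.finrank_mono hle) _).trans key

open Classical in
/-- Edges between identified vertices are loops and do not contribute to the rank. -/
theorem wiredRank_union_of_loops {Q : Set V} (A : Finset E) {L : Finset E}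
    (hL : ∀ e ∈ L, ∀ x ∈ (e : Sym2 V), x ∈ Q) : wiredRank Q (A ∪ L) = wiredRank Q A := by
  have h : edgeSpan (wiredImage Q L) = ⊥ := by
    rw [eq_bot_iff, edgeSpan, Submodule.span_le]
    rintro _ ⟨_, ⟨e, he, rfl⟩, rfl⟩
    rw [SetLike.mem_coe, Submodule.mem_bot]
    refine edgeVec_of_isDiag ?_
    obtain ⟨⟨x, y⟩, hxy⟩ := e.1.exists_rep
    have hx := hL e he x (by rw [← hxy]; exact Sym2.mem_mk_left x y)
    have hy := hL e he y (by rw [← hxy]; exact Sym2.mem_mk_right x y)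
    change (Sym2.map (wireMap Q) e.1).IsDiag
    rw [← hxy]
    change (Sym2.map (wireMap Q) s(x, y)).IsDiag
    simp [wireMap, hx, hy]
  rw [wiredRank, wiredImage, Finset.coe_union, Set.image_union, edgeSpan_union]
  change Module.finrank (ZMod 2) ↥(edgeSpan (wiredImage Q A) ⊔ edgeSpan (wiredImage Q L)) = _
  rw [h, sup_bot_eq]; rfl

/-- The weight of the set `A` of open edges when the vertices of `Q` are identified, up to a factor
that depends on the finite volume only. -/
noncomputable def weight (p q : ℝ) (Q : Set V) (A : Finset E) : ℝ :=
  (p / (1 - p)) ^ A.card * q⁻¹ ^ wiredRank Q A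

variable {p q : ℝ}

theorem weight_pos (hp0 : 0 < p) (hp1 : p < 1) (hq : 1 ≤ q) (Q : Set V) (A : Finset E) :
    0 < weight p q Q A := by
  have : 0 < 1 - p := by linarith
  have : 0 < q := by linarith
  unfold weight
  positivity

open Classical in
/-- The Holley lattice condition for random cluster weights. -/
theorem weight_mul_weight_le (hp0 : 0 < p) (hp1 : p < 1) (hq : 1 ≤ q) {Q Q' : Set V} (h : Q ⊆ Q')
    (A B : Finset E) :
    weight p q Q A * weight p q Q' B ≤ weight p q Q (A ∩ B) * weight p q Q' (A ∪ B) := by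
  have h1 : 0 < 1 - p := by linarith
  have hrank := wiredRank_inter_add_wiredRank_union_le h A B
  unfold weight
  rw [mul_mul_mul_comm, mul_mul_mul_comm (_ ^ (A ∩ B).card), ← pow_add, ← pow_add, ← pow_add,
    ← pow_add, Finset.card_inter_add_card_union]
  exact mul_le_mul_of_nonneg_left
    (pow_le_pow_of_le_one (by positivity) (inv_le_one_of_one_le₀ hq) hrank) (by positivity)

open Classical in
/-- The configuration whose open edges are those of `A`. -/
noncomputable def openConfig (A : Finset E) : Config E := fun e => decide (e ∈ A)

/-- `ν` is the normalised law with weights `weight p q Q` on the subsets of the finite edge set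
`F`. -/
def HasRCLaw (p q : ℝ) (Q : Set V) (F : Finset E) (ν : Measure (Config E)) : Prop :=
  ∀ S, MeasurableSet S → ν.real S =
    (∑ A ∈ F.powerset, S.indicator (fun _ => weight p q Q A) (openConfig A)) /
      ∑ A ∈ F.powerset, weight p q Q A

theorem sum_weight_pos (hp0 : 0 < p) (hp1 : p < 1) (hq : 1 ≤ q) (Q : Set V) (F : Finset E) :
    0 < ∑ A ∈ F.powerset, weight p q Q A :=
  Finset.sum_pos (fun _ _ => weight_pos hp0 hp1 hq _ _) ⟨∅, by simp⟩

theorem HasRCLaw.isProbabilityMeasure {Q : Set V} {F : Finset E} {ν : Measure (Config E)}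
    (h : HasRCLaw p q Q F ν) (hp0 : 0 < p) (hp1 : p < 1) (hq : 1 ≤ q) :
    IsProbabilityMeasure ν := by
  refine ⟨?_⟩
  have := h Set.univ .univ
  simp only [Set.indicator_univ, div_self (sum_weight_pos hp0 hp1 hq Q F).ne'] at this
  exact (ENNReal.toReal_eq_one_iff _).1 this

end Weights

/-! ### Finite-volume measures in terms of the weights -/

section FiniteVolume

variable {V : Type*} (E : Set (Sym2 V)) (Λ : Finset V)

/-- The edges of the subgraph induced by `Λ`, as a finite set. -/
noncomputable def volumeEdges : Finset E := (inducedEdges E Λ).toFinset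

variable {E Λ}

@[simp] theorem mem_volumeEdges {e : E} : e ∈ volumeEdges E Λ ↔ ∀ x ∈ (e : Sym2 V), x ∈ Λ := by
  rw [volumeEdges, Set.mem_toFinset]; rfl

variable {p q : ℝ}

open Classical in
/-- The open edges of a configuration in the volume `Λ`. -/
noncomputable def openEdges (ω : inducedEdges E Λ → Bool) : Finset E :=
  (volumeEdges E Λ).filter fun e => extendConfig E Λ ω e = true

theorem openConfig_openEdges (ω : inducedEdges E Λ → Bool) :
    openConfig (openEdges ω) = extendConfig E Λ ω := by
  funext e
  by_cases he : e ∈ inducedEdges E Λ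
  · have : e ∈ volumeEdges E Λ := by simpa [volumeEdges] using he
    simp [openConfig, openEdges, this]
  · have : e ∉ volumeEdges E Λ := by simpa [volumeEdges] using he
    simp only [openConfig, openEdges, Finset.mem_filter, this]
    simp [extendConfig, he]

theorem coe_openEdges (ω : inducedEdges E Λ → Bool) :
    (openEdges ω : Set E) = Subtype.val '' {e | ω e = true} := by
  ext e
  simp only [openEdges, Finset.coe_filter, Set.mem_ofPred_eq, Set.mem_image, Subtype.exists,
    exists_and_right, exists_eq_right]
  constructor
  · rintro ⟨h1, h2⟩
    have he : e ∈ inducedEdges E Λ := by simpa [volumeEdges] using h1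
    exact ⟨he, by simpa [extendConfig, he] using h2⟩
  · rintro ⟨he, h⟩
    exact ⟨by simpa [volumeEdges] using he, by simpa [extendConfig, he] using h⟩

open Classical in
/-- Configurations in the volume `Λ` correspond to sets of open edges. -/
theorem sum_openEdges (g : Finset E → ℝ) :
    ∑ ω : inducedEdges E Λ → Bool, g (openEdges ω) = ∑ A ∈ (volumeEdges E Λ).powerset, g A := by
  refine Finset.sum_bij' (fun ω _ => openEdges ω) (fun A _ e => decide ((e : E) ∈ A)) ?_ ?_ ?_ ?_ ?_
  · intro ω _; simp [openEdges]
  · intro A _; simp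
  · intro ω _
    funext e
    have : (e : E) ∈ volumeEdges E Λ := by simp [volumeEdges]
    simp [openEdges, this, extendConfig]
  · intro A hA
    ext e
    have hA' := Finset.mem_powerset.1 hA
    simp only [openEdges, Finset.mem_filter]
    constructor
    · rintro ⟨h1, h2⟩
      have he : e ∈ inducedEdges E Λ := by simpa [volumeEdges] using h1
      simpa [extendConfig, he] using h2
    · intro h
      have he : e ∈ inducedEdges E Λ := by simpa [volumeEdges] using hA' h
      exact ⟨hA' h, by simpa [extendConfig, he] using h⟩
  · intro ω _; rfl

/-- The number of components is the number of vertices minus the rank, so random cluster weights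
are proportional to `weight`. -/
theorem rcWeight_eq_mul_weight (hp1 : p < 1) (hq : 1 ≤ q) {W : Type*} [Finite W]
    (ends : inducedEdges E Λ → Sym2 W) (Q : Set V) (j : W → Option V) (hj : Function.Injective j)
    (hends : ∀ e, (ends e).map j = (e.1 : Sym2 V).map (wireMap Q)) (ω : inducedEdges E Λ → Bool) :
    rcWeight p q ends ω = (1 - p) ^ Fintype.card (inducedEdges E Λ) * q ^ Nat.card W *
      weight p q Q (openEdges ω) := by
  classical
  have h1 : 1 - p ≠ 0 := by linarith
  have hq0 : q ≠ 0 := by linarith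
  have hcard : (openEdges ω).card = (Finset.univ.filter fun e => ω e = true).card := by
    have : openEdges ω =
        (Finset.univ.filter fun e => ω e = true).map (Function.Embedding.subtype _) := by
      rw [← Finset.coe_inj, coe_openEdges]; simp
    rw [this, Finset.card_map]
  have hprod : (∏ e, if ω e = true then p else 1 - p) =
      (1 - p) ^ Fintype.card (inducedEdges E Λ) * (p / (1 - p)) ^ (openEdges ω).card := by
    rw [hcard, ← Finset.card_univ, ← Finset.prod_const, ← Finset.prod_const, Finset.prod_filter,
      ← Finset.prod_mul_distrib]
    refine Finset.prod_congr rfl fun e _ => ?_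
    split_ifs
    · field_simp
    · simp
  have himage : Sym2.map j '' {z : Sym2 W | ∃ e, ω e = true ∧ ends e = z} =
      wiredImage Q (openEdges ω) := by
    rw [wiredImage, coe_openEdges, Set.image_image]
    ext z
    constructor
    · rintro ⟨_, ⟨e, he, rfl⟩, rfl⟩; exact ⟨e, he, (hends e).symm⟩
    · rintro ⟨e, he, rfl⟩; exact ⟨_, ⟨e, he, rfl⟩, hends e⟩
  have hcomp : numComponents ends ω + wiredRank Q (openEdges ω) = Nat.card W := by
    rw [wiredRank, ← himage, finrank_edgeSpan_image hj]
    exact card_connectedComponent_add_finrank_edgeSpan _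
  rw [rcWeight, hprod, weight, ← hcomp, pow_add, inv_pow]
  field_simp

/-- The definition of `rcMeasure`, with an arbitrary decidability instance. -/
theorem rcMeasure_eq_sum {W F : Type*} [Fintype F] [DecidableEq F] (ends : F → Sym2 W) :
    rcMeasure p q ends = ∑ ω : F → Bool,
      ENNReal.ofReal (rcWeight p q ends ω / ∑ η : F → Bool, rcWeight p q ends η) •
        Measure.dirac ω := by
  unfold rcMeasure
  congr!

theorem hasRCLaw_map_rcMeasure (hp0 : 0 < p) (hp1 : p < 1) (hq : 1 ≤ q) {W : Type*} [Finite W]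
    (ends : inducedEdges E Λ → Sym2 W) (Q : Set V) (j : W → Option V) (hj : Function.Injective j)
    (hends : ∀ e, (ends e).map j = (e.1 : Sym2 V).map (wireMap Q)) :
    HasRCLaw p q Q (volumeEdges E Λ) ((rcMeasure p q ends).map (extendConfig E Λ)) := by
  classical
  intro S hS
  set c : ℝ := (1 - p) ^ Fintype.card (inducedEdges E Λ) * q ^ Nat.card W
  have hc : 0 < c := by
    have : 0 < 1 - p := by linarith
    have : 0 < q := by linarith
    positivity
  have hw : ∀ ω, rcWeight p q ends ω = c * weight p q Q (openEdges ω) :=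
    rcWeight_eq_mul_weight hp1 hq ends Q j hj hends
  have hZ : ∑ ω, rcWeight p q ends ω = c * ∑ A ∈ (volumeEdges E Λ).powerset, weight p q Q A := by
    simp_rw [hw]
    rw [← Finset.mul_sum, sum_openEdges fun A => weight p q Q A]
  have hmeas : Measurable (extendConfig E Λ) := Measurable.of_discrete
  rw [measureReal_def, Measure.map_apply hmeas hS, rcMeasure_eq_sum, Measure.finsetSum_apply,
    ENNReal.toReal_sum fun ω _ => by
      rw [Measure.smul_apply, smul_eq_mul]
      exact ENNReal.mul_ne_top ENNReal.ofReal_ne_top (measure_ne_top _ _),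
    Finset.sum_div,
    ← sum_openEdges fun A => S.indicator (fun _ => weight p q Q A) (openConfig A) /
      ∑ A ∈ (volumeEdges E Λ).powerset, weight p q Q A]
  refine Finset.sum_congr rfl fun ω _ => ?_
  have hpos := sum_weight_pos hp0 hp1 hq Q (volumeEdges E Λ)
  have hwp := weight_pos hp0 hp1 hq Q (openEdges ω)
  rw [hZ, hw, mul_div_mul_left _ _ hc.ne', openConfig_openEdges, Measure.smul_apply, smul_eq_mul,
    ENNReal.toReal_mul, ENNReal.toReal_ofReal (by positivity), Measure.dirac_apply]
  by_cases hωS : extendConfig E Λ ω ∈ S <;> simp [Set.indicator, hωS]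

end FiniteVolume

/-! ### Comparison of volumes by the four functions theorem -/

section Comparison

variable {V : Type*} {E : Set (Sym2 V)} {p q : ℝ}

theorem closeOff_openConfig_congr {F A B : Finset E} (h : ∀ e ∉ F, e ∈ A ↔ e ∈ B) :
    closeOff F (openConfig A) = closeOff F (openConfig B) := by
  funext e
  by_cases he : e ∈ F
  · simp [closeOff, he]
  · simp [closeOff, he, openConfig, h e he]

theorem div_mul_div_le_div {a b c z z' : ℝ} (hz : 0 < z) (hz' : 0 < z') (h : a * b ≤ z * c) :
    a / z * (b / z') ≤ c / z' := by
  rw [div_mul_div_comm, div_le_div_iff₀ (by positivity) hz']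
  nlinarith

/-- Free boundary: opening edges outside `F` helps increasing events inside `F`. -/
theorem HasRCLaw.mul_le_of_free (hp0 : 0 < p) (hp1 : p < 1) (hq : 1 ≤ q) {Q : Set V}
    {F F' : Finset E} (hF : F ⊆ F') {ν ν' : Measure (Config E)} (hν : HasRCLaw p q Q F ν)
    (hν' : HasRCLaw p q Q F' ν') (K : Finset E) {B : Set (Config E)} (hB : MeasurableSet B) :
    ν.real (agreeOn true K) * ν'.real (closeOff F ⁻¹' B) ≤
      ν'.real (agreeOn true K ∩ closeOff F ⁻¹' B) := by
  classical
  have hM := measurableSet_agreeOn true K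
  have hC := measurable_closeOff F hB
  have hw : ∀ A : Finset E, 0 ≤ weight p q Q A := fun A => (weight_pos hp0 hp1 hq Q A).le
  rw [hν _ hM, hν' _ hC, hν' _ (hM.inter hC)]
  refine div_mul_div_le_div (sum_weight_pos hp0 hp1 hq Q F) (sum_weight_pos hp0 hp1 hq Q F') ?_
  have key := four_functions_theorem
    (fun A : Finset E => if A ⊆ F then
      (agreeOn true K).indicator (fun _ => weight p q Q A) (openConfig A) else 0)
    (fun A => (closeOff F ⁻¹' B).indicator (fun _ => weight p q Q A) (openConfig A))
    (fun A => weight p q Q A)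
    (fun A => (agreeOn true K ∩ closeOff F ⁻¹' B).indicator (fun _ => weight p q Q A)
      (openConfig A))
    (fun A => by
      dsimp only [Pi.zero_apply]
      split_ifs
      exacts [Set.indicator_nonneg (fun _ _ => hw A) _, le_rfl])
    (fun A => Set.indicator_nonneg (fun _ _ => hw A) _) hw
    (fun A => Set.indicator_nonneg (fun _ _ => hw A) _) ?_ F.powerset F'.powerset
  · rw [Finset.sum_congr rfl fun A hA => if_pos (Finset.mem_powerset.1 hA)] at key
    refine key.trans (mul_le_mul ?_ ?_ ?_ ?_)
    · refine Finset.sum_le_sum_of_subset_of_nonneg ?_ fun A _ _ => hw A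
      intro A hA
      obtain ⟨A₁, h₁, A₂, -, rfl⟩ := Finset.mem_infs.1 hA
      exact Finset.mem_powerset.2 (Finset.inter_subset_left.trans (Finset.mem_powerset.1 h₁))
    · refine Finset.sum_le_sum_of_subset_of_nonneg ?_ fun A _ _ =>
        Set.indicator_nonneg (fun _ _ => hw A) _
      intro A hA
      obtain ⟨A₁, h₁, A₂, h₂, rfl⟩ := Finset.mem_sups.1 hA
      exact Finset.mem_powerset.2 (Finset.union_subset ((Finset.mem_powerset.1 h₁).trans hF)
        (Finset.mem_powerset.1 h₂))
    · exact Finset.sum_nonneg fun A _ => Set.indicator_nonneg (fun _ _ => hw A) _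
    · exact Finset.sum_nonneg fun A _ => hw A
  · intro A A'
    have hr : 0 ≤ weight p q Q (A ⊓ A') *
        (agreeOn true K ∩ closeOff F ⁻¹' B).indicator (fun _ => weight p q Q (A ⊔ A'))
          (openConfig (A ⊔ A')) :=
      mul_nonneg (hw _) (Set.indicator_nonneg (fun _ _ => hw _) _)
    by_cases h1 : A ⊆ F
    swap; · simpa [h1] using hr
    by_cases h2 : openConfig A ∈ agreeOn true K
    swap; · simpa [h2] using hr
    by_cases h3 : openConfig A' ∈ closeOff F ⁻¹' B
    swap; · simpa only [Set.indicator_of_notMem h3, mul_zero] using hr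
    have h4 : openConfig (A ⊔ A') ∈ agreeOn true K ∩ closeOff F ⁻¹' B := by
      refine ⟨fun e he => ?_, ?_⟩
      · have := h2 e he
        simp only [openConfig, decide_eq_true_eq] at this
        simp [openConfig, this]
      · have hc : closeOff F (openConfig (A ⊔ A')) = closeOff F (openConfig A') :=
          closeOff_openConfig_congr fun e he => by
            simp only [Finset.sup_eq_union, Finset.mem_union, or_iff_right_iff_imp]
            exact fun hA => absurd (h1 hA) he
        rw [Set.mem_preimage, hc]
        exact h3
    simp only [h1, if_true, Set.indicator_of_mem h2, Set.indicator_of_mem h3,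
      Set.indicator_of_mem h4]
    exact weight_mul_weight_le hp0 hp1 hq subset_rfl A A'

/-- Wired boundary: closing edges outside `F`, or identifying fewer vertices, helps decreasing
events inside `F`.  The smaller volume is compared inside the larger one by opening all edges of
`F' \ F`, which are loops after the identification of `Q`. -/
theorem HasRCLaw.mul_le_of_wired (hp0 : 0 < p) (hp1 : p < 1) (hq : 1 ≤ q) {Q Q' : Set V}
    (hQ : Q' ⊆ Q) {F F' : Finset E}
    (hloops : ∀ e ∈ F', e ∉ F → ∀ x ∈ (e : Sym2 V), x ∈ Q)
    {ν ν' : Measure (Config E)} (hν : HasRCLaw p q Q F ν) (hν' : HasRCLaw p q Q' F' ν')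
    {K : Finset E} (hK : K ⊆ F) {B : Set (Config E)} (hB : MeasurableSet B) :
    ν.real (agreeOn false K) * ν'.real (closeOff F ⁻¹' B) ≤
      ν'.real (agreeOn false K ∩ closeOff F ⁻¹' B) := by
  classical
  have hM := measurableSet_agreeOn false K
  have hC := measurable_closeOff F hB
  have hw : ∀ (R : Set V) (A : Finset E), 0 ≤ weight p q R A :=
    fun R A => (weight_pos hp0 hp1 hq R A).le
  rw [hν _ hM, hν' _ hC, hν' _ (hM.inter hC)]
  refine div_mul_div_le_div (sum_weight_pos hp0 hp1 hq Q F) (sum_weight_pos hp0 hp1 hq Q' F') ?_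
  set L := F' \ F with hL
  have hdisj : ∀ A ⊆ F, Disjoint A L := fun A hA =>
    Finset.disjoint_of_subset_left hA Finset.disjoint_sdiff
  set c : ℝ := (p / (1 - p)) ^ L.card
  have hc : 0 < c := by
    have : 0 < 1 - p := by linarith
    positivity
  have hwL : ∀ A ⊆ F, weight p q Q (A ∪ L) = c * weight p q Q A := by
    intro A hA
    rw [weight, weight, Finset.card_union_of_disjoint (hdisj A hA), wiredRank_union_of_loops,
      pow_add]
    · ring
    · intro e he
      exact hloops e (Finset.mem_sdiff.1 he).1 (Finset.mem_sdiff.1 he).2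
  have hinj : Set.InjOn (· ∪ L) (F.powerset : Set (Finset E)) := by
    intro A hA A' hA' h
    have hA := hdisj A (Finset.mem_powerset.1 hA)
    have hA' := hdisj A' (Finset.mem_powerset.1 hA')
    rw [← Finset.union_sdiff_cancel_right hA, ← Finset.union_sdiff_cancel_right hA']
    exact congrArg (· \ L) h
  set t := F.powerset.image (· ∪ L)
  have hsum : ∀ S : Set (Config E), (∀ A ⊆ F, openConfig (A ∪ L) ∈ S ↔ openConfig A ∈ S) →
      ∑ A ∈ t, S.indicator (fun _ => weight p q Q A) (openConfig A) =
        c * ∑ A ∈ F.powerset, S.indicator (fun _ => weight p q Q A) (openConfig A) := by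
    intro S hS
    rw [Finset.sum_image hinj, Finset.mul_sum]
    refine Finset.sum_congr rfl fun A hA => ?_
    have hA := Finset.mem_powerset.1 hA
    by_cases h : openConfig A ∈ S
    · rw [Set.indicator_of_mem h, Set.indicator_of_mem ((hS A hA).2 h), hwL A hA]
    · rw [Set.indicator_of_notMem h, Set.indicator_of_notMem (fun h' => h ((hS A hA).1 h')),
        mul_zero]
  have hsumM := hsum (agreeOn false K) fun A hA => by
    have : ∀ e ∈ K, e ∉ L := fun e he => by simp [hL, hK he]
    simp +contextual [agreeOn, openConfig, this]
  have hsumU := hsum Set.univ fun A hA => by simp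
  simp only [Set.indicator_univ] at hsumU
  have key := four_functions_theorem
    (fun A : Finset E => if A ⊆ F' then
      (closeOff F ⁻¹' B).indicator (fun _ => weight p q Q' A) (openConfig A) else 0)
    (fun A => if L ⊆ A then
      (agreeOn false K).indicator (fun _ => weight p q Q A) (openConfig A) else 0)
    (fun A => (agreeOn false K ∩ closeOff F ⁻¹' B).indicator (fun _ => weight p q Q' A)
      (openConfig A))
    (fun A => weight p q Q A)
    (fun A => by
      dsimp only [Pi.zero_apply]
      split_ifs
      exacts [Set.indicator_nonneg (fun _ _ => hw _ A) _, le_rfl])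
    (fun A => by
      dsimp only [Pi.zero_apply]
      split_ifs
      exacts [Set.indicator_nonneg (fun _ _ => hw _ A) _, le_rfl])
    (fun A => Set.indicator_nonneg (fun _ _ => hw _ A) _) (hw Q) ?_ F'.powerset t
  · have ht : ∀ A ∈ t, L ⊆ A := by
      intro A hA
      obtain ⟨A, -, rfl⟩ := Finset.mem_image.1 hA
      exact Finset.subset_union_right
    rw [Finset.sum_congr rfl fun A hA => if_pos (Finset.mem_powerset.1 hA),
      Finset.sum_congr rfl fun A hA => if_pos (ht A hA), hsumM] at key
    have hle := key.trans (mul_le_mul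
      (b := ∑ A ∈ F'.powerset, (agreeOn false K ∩ closeOff F ⁻¹' B).indicator
        (fun _ => weight p q Q' A) (openConfig A))
      (d := ∑ A ∈ t, weight p q Q A) ?_ ?_ ?_ ?_)
    · rw [hsumU] at hle
      refine le_of_mul_le_mul_left ?_ hc
      linarith
    · refine Finset.sum_le_sum_of_subset_of_nonneg ?_ fun A _ _ =>
        Set.indicator_nonneg (fun _ _ => hw _ A) _
      intro A hA
      obtain ⟨A₁, h₁, A₂, -, rfl⟩ := Finset.mem_infs.1 hA
      exact Finset.mem_powerset.2 (Finset.inter_subset_left.trans (Finset.mem_powerset.1 h₁))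
    · refine Finset.sum_le_sum_of_subset_of_nonneg ?_ fun A _ _ => hw _ A
      intro A hA
      obtain ⟨A₁, h₁, A₂, h₂, rfl⟩ := Finset.mem_sups.1 hA
      obtain ⟨A₃, h₃, rfl⟩ := Finset.mem_image.1 h₂
      have h₁ := Finset.mem_powerset.1 h₁
      have h₃ := Finset.mem_powerset.1 h₃
      refine Finset.mem_image.2 ⟨(A₁ ∩ F) ∪ A₃, Finset.mem_powerset.2
        (Finset.union_subset Finset.inter_subset_right h₃), ?_⟩
      ext e
      have := @h₁ e
      simp only [hL, Finset.sup_eq_union, Finset.mem_union, Finset.mem_inter, Finset.mem_sdiff]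
      tauto
    · exact Finset.sum_nonneg fun A _ => hw _ A
    · exact Finset.sum_nonneg fun A _ => Set.indicator_nonneg (fun _ _ => hw _ A) _
  · intro A A'
    have hr : 0 ≤ (agreeOn false K ∩ closeOff F ⁻¹' B).indicator
        (fun _ => weight p q Q' (A ⊓ A')) (openConfig (A ⊓ A')) * weight p q Q (A ⊔ A') :=
      mul_nonneg (Set.indicator_nonneg (fun _ _ => hw _ _) _) (hw _ _)
    by_cases h1 : A ⊆ F'
    swap; · simpa [h1] using hr
    by_cases h1' : L ⊆ A'
    swap; · simpa [h1'] using hr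
    by_cases h2 : openConfig A' ∈ agreeOn false K
    swap; · simpa [h2] using hr
    by_cases h3 : openConfig A ∈ closeOff F ⁻¹' B
    swap; · simpa only [Set.indicator_of_notMem h3, ite_self, zero_mul] using hr
    have h4 : openConfig (A ⊓ A') ∈ agreeOn false K ∩ closeOff F ⁻¹' B := by
      refine ⟨fun e he => ?_, ?_⟩
      · have := h2 e he
        simp only [openConfig, decide_eq_false_iff_not] at this
        simp [openConfig, this]
      · have hc : closeOff F (openConfig (A ⊓ A')) = closeOff F (openConfig A) :=
          closeOff_openConfig_congr fun e he => by
            simp only [Finset.inf_eq_inter, Finset.mem_inter, and_iff_left_iff_imp]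
            exact fun hA => h1' (Finset.mem_sdiff.2 ⟨h1 hA, he⟩)
        rw [Set.mem_preimage, hc]
        exact h3
    simp only [h1, h1', if_true, Set.indicator_of_mem h2, Set.indicator_of_mem h3,
      Set.indicator_of_mem h4]
    exact weight_mul_weight_le hp0 hp1 hq hQ A A'

end Comparison

/-! ### The free and the wired family -/

section Families

variable {V : Type*} {E : Set (Sym2 V)} {p q : ℝ}

theorem volumeEdges_mono : Monotone (volumeEdges E) := fun Λ Λ' h e he => by
  rw [mem_volumeEdges] at *
  exact fun x hx => h (he x hx)

theorem exists_subset_volumeEdges (K : Finset E) : ∃ Λ, K ⊆ volumeEdges E Λ := by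
  classical
  refine ⟨K.biUnion fun e => (e : Sym2 V).toFinset, fun e he => ?_⟩
  rw [mem_volumeEdges]
  exact fun x hx => Finset.mem_biUnion.2 ⟨e, he, by simpa using hx⟩

variable (E) in
/-- The vertices that the wired boundary condition on `Λ` identifies: the internal boundary of `Λ`
together with the complement of `Λ`. -/
def wiredSet (Λ : Finset V) : Set V := {x | x ∉ Λ ∨ x ∈ internalBoundary E Λ}

theorem wiredSet_antitone : Antitone (wiredSet E) := by
  rintro Λ Λ' h x (hx | ⟨-, y, hy, hxy⟩)
  · exact .inl fun hx' => hx (h hx')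
  · by_cases hx : x ∈ Λ
    · exact .inr ⟨hx, y, fun hy' => hy (h hy'), hxy⟩
    · exact .inl hx

theorem mem_wiredSet_of_notMem_volumeEdges {Λ : Finset V} {e : E} (he : e ∉ volumeEdges E Λ) :
    ∀ x ∈ (e : Sym2 V), x ∈ wiredSet E Λ := by
  intro x hx
  by_cases hxΛ : x ∈ Λ
  swap; · exact .inl hxΛ
  obtain ⟨y, hy⟩ := Sym2.mem_iff_exists.1 hx
  refine .inr ⟨hxΛ, y, fun hyΛ => he ?_, hy ▸ e.2⟩
  rw [mem_volumeEdges, hy]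
  intro z hz
  rcases Sym2.mem_iff.1 hz with rfl | rfl
  exacts [hxΛ, hyΛ]

theorem map_val_inducedEnds {Λ : Finset V} (e : inducedEdges E Λ) :
    (inducedEnds E Λ e).map Subtype.val = (e.1 : Sym2 V) := Sym2.attachWith_map_subtypeVal _

theorem hasRCLaw_freeVolume (hp0 : 0 < p) (hp1 : p < 1) (hq : 1 ≤ q) (Λ : Finset V) :
    HasRCLaw p q ∅ (volumeEdges E Λ) (freeVolume E Λ p q) := by
  refine hasRCLaw_map_rcMeasure hp0 hp1 hq _ ∅ (fun x => wireMap ∅ x.1) ?_ fun e => ?_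
  · intro x y h
    exact Subtype.ext (by simpa [wireMap] using h)
  · have : (fun x : {x : V // x ∈ Λ} => wireMap ∅ x.1) = wireMap ∅ ∘ Subtype.val := rfl
    rw [this, ← Sym2.map_map, map_val_inducedEnds]

theorem hasRCLaw_wiredVolume (hp0 : 0 < p) (hp1 : p < 1) (hq : 1 ≤ q) (Λ : Finset V) :
    HasRCLaw p q (wiredSet E Λ) (volumeEdges E Λ) (wiredVolume E Λ p q) := by
  have hmem : ∀ x : {x : V // x ∈ Λ}, x.1 ∈ wiredSet E Λ ↔ x.1 ∈ internalBoundary E Λ :=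
    fun x => or_iff_right (not_not_intro x.2)
  have hlift : ∀ x y : {x : V // x ∈ Λ}, (wiring E Λ) x y ↔
      wireMap (wiredSet E Λ) x.1 = wireMap (wiredSet E Λ) y.1 := by
    intro x y
    change (x = y ∨ _) ↔ _
    rw [← hmem, ← hmem, Subtype.ext_iff]
    by_cases hx : x.1 ∈ wiredSet E Λ <;> by_cases hy : y.1 ∈ wiredSet E Λ <;>
      simp only [wireMap, hx, hy, if_true, if_false, and_self, and_true, and_false, or_true,
        or_false, Option.some.injEq, reduceCtorEq, iff_false]
    · exact fun h => hy (h ▸ hx)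
    · exact fun h => hx (h ▸ hy)
  refine hasRCLaw_map_rcMeasure hp0 hp1 hq _ _
    (Quotient.lift (fun x => wireMap (wiredSet E Λ) x.1) fun x y h => (hlift x y).1 h) ?_
    fun e => ?_
  · rintro ⟨x⟩ ⟨y⟩ h
    exact Quotient.sound ((hlift x y).2 h)
  · have : Quotient.lift (fun x : {x : V // x ∈ Λ} => wireMap (wiredSet E Λ) x.1)
        (fun x y h => (hlift x y).1 h) ∘ Quotient.mk (wiring E Λ) =
        wireMap (wiredSet E Λ) ∘ Subtype.val := rfl
    rw [wiredEnds, Sym2.map_map, this, ← Sym2.map_map, map_val_inducedEnds]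

theorem isMonotoneFamily_free (hp0 : 0 < p) (hp1 : p < 1) (hq : 1 ≤ q)
    {ν : Finset V → ProbabilityMeasure (Config E)}
    (hν : ∀ Λ, HasRCLaw p q ∅ (volumeEdges E Λ) (ν Λ : Measure (Config E))) :
    IsMonotoneFamily true (volumeEdges E) ν where
  mono := volumeEdges_mono
  exhausts := exists_subset_volumeEdges
  mul_le Λ Λ' h K _ _ hB :=
    (hν Λ).mul_le_of_free hp0 hp1 hq (volumeEdges_mono h) (hν Λ') K hB

theorem isMonotoneFamily_wired (hp0 : 0 < p) (hp1 : p < 1) (hq : 1 ≤ q)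
    {ν : Finset V → ProbabilityMeasure (Config E)}
    (hν : ∀ Λ, HasRCLaw p q (wiredSet E Λ) (volumeEdges E Λ) (ν Λ : Measure (Config E))) :
    IsMonotoneFamily false (volumeEdges E) ν where
  mono := volumeEdges_mono
  exhausts := exists_subset_volumeEdges
  mul_le Λ Λ' h _ hK _ hB :=
    (hν Λ).mul_le_of_wired hp0 hp1 hq (wiredSet_antitone h)
      (fun _ _ he => mem_wiredSet_of_notMem_volumeEdges he) (hν Λ') hK hB

end Families

/-! ### Exhaustions and limits -/

section Exhaustions

variable {V : Type*} {E : Set (Sym2 V)}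

theorem IsExhaustion.tendsto_atTop {Λ : ℕ → Finset V} (h : IsExhaustion Λ) :
    Tendsto Λ atTop atTop := by
  classical
  refine tendsto_atTop_atTop_of_monotone h.mono fun S => ?_
  choose n hn using h.exhausts
  exact ⟨S.sup n, fun x hx => h.mono (Finset.le_sup hx) (hn x)⟩

theorem exists_isExhaustion (V : Type*) [Countable V] : ∃ Λ : ℕ → Finset V, IsExhaustion Λ := by
  classical
  obtain ⟨f, hf⟩ := exists_injective_nat V
  have hfin : ∀ n, {x | f x ≤ n}.Finite := fun n => (Set.finite_Iic n).preimage hf.injOn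
  refine ⟨fun n => (hfin n).toFinset, fun m n hmn x => ?_, fun x => ⟨f x, by simp⟩⟩
  simp only [Set.Finite.mem_toFinset, Set.mem_ofPred_eq]
  exact fun h => h.trans hmn

theorem weakLimit_iff_tendsto [Countable V] {ν : ℕ → ProbabilityMeasure (Config E)}
    {μ : ProbabilityMeasure (Config E)} :
    WeakLimit (fun n => (ν n : Measure (Config E))) (μ : Measure (Config E)) ↔
      Tendsto ν atTop (𝓝 μ) := by
  rw [ProbabilityMeasure.tendsto_iff_forall_integral_tendsto]
  exact ⟨fun h f => h f.toContinuousMap, fun h f => h (BoundedContinuousFunction.mkOfCompact f)⟩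

/-- The limit along every exhaustion is the limit along the directed set of finite volumes, as soon
as the latter exists. -/
theorem forall_weakLimit_iff_tendsto [Countable V] {ν : Finset V → ProbabilityMeasure (Config E)}
    (hν : ∃ μ, Tendsto ν atTop (𝓝 μ)) (μ : ProbabilityMeasure (Config E)) :
    (∀ Λ : ℕ → Finset V, IsExhaustion Λ →
      WeakLimit (fun n => (ν (Λ n) : Measure (Config E))) (μ : Measure (Config E))) ↔
      Tendsto ν atTop (𝓝 μ) := by
  refine ⟨fun h => ?_, fun h Λ hΛ => weakLimit_iff_tendsto.2 (h.comp hΛ.tendsto_atTop)⟩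
  obtain ⟨μ', hμ'⟩ := hν
  obtain ⟨Λ, hΛ⟩ := exists_isExhaustion V
  have h1 : Tendsto (fun n => ν (Λ n)) atTop (𝓝 μ) := weakLimit_iff_tendsto.1 (h Λ hΛ)
  rwa [tendsto_nhds_unique h1 (hμ'.comp hΛ.tendsto_atTop)]

end Exhaustions

/-! ### Invariance under automorphisms -/

section Invariance

variable {V : Type*} {E : Set (Sym2 V)} {p q : ℝ}

theorem coe_smul_edge (g : graphAut E) (e : E) :
    ((g • e : E) : Sym2 V) = (e : Sym2 V).map (g : Equiv.Perm V) := rfl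

theorem smul_config_apply (g : graphAut E) (ω : Config E) (e : E) : (g • ω) e = ω (g⁻¹ • e) := rfl

theorem continuous_smul_config (g : graphAut E) : Continuous fun ω : Config E => g • ω :=
  continuous_pi fun e => continuous_apply (g⁻¹ • e)

theorem measurable_smul_config (g : graphAut E) : Measurable fun ω : Config E => g • ω :=
  measurable_pi_lambda _ fun e => measurable_pi_apply (g⁻¹ • e)

/-- The image of a finite set of edges under an automorphism. -/
noncomputable def mapEdges (g : graphAut E) : Finset E ≃ Finset E :=
  (MulAction.toPerm g : Equiv.Perm E).finsetCongr

theorem mem_mapEdges {g : graphAut E} {A : Finset E} {e : E} :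
    e ∈ mapEdges g A ↔ g⁻¹ • e ∈ A := by
  simp [mapEdges, Finset.mem_map_equiv, MulAction.toPerm_symm_apply]

theorem openConfig_mapEdges (g : graphAut E) (A : Finset E) :
    openConfig (mapEdges g A) = g • openConfig A := by
  funext e
  simp [smul_config_apply, openConfig, mem_mapEdges]

theorem weight_mapEdges (g : graphAut E) (Q : Set V) (A : Finset E) :
    weight p q ((g : Equiv.Perm V) '' Q) (mapEdges g A) = weight p q Q A := by
  have hcomm : wireMap ((g : Equiv.Perm V) '' Q) ∘ (g : Equiv.Perm V) =
      Option.map (g : Equiv.Perm V) ∘ wireMap Q := by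
    funext x
    by_cases hx : x ∈ Q <;> simp [wireMap, hx]
  have himage : wiredImage ((g : Equiv.Perm V) '' Q) (mapEdges g A) =
      Sym2.map (Option.map (g : Equiv.Perm V)) '' wiredImage Q A := by
    have : (mapEdges g A : Set E) = (fun e => g • e) '' (A : Set E) := by
      simp [mapEdges]
    rw [wiredImage, this, wiredImage, Set.image_image, Set.image_image]
    simp_rw [coe_smul_edge, Sym2.map_map, hcomm]
  rw [weight, weight, wiredRank, himage,
    finrank_edgeSpan_image (Option.map_injective (g : Equiv.Perm V).injective), wiredRank]
  simp [mapEdges]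

theorem HasRCLaw.measureReal_smul_preimage {g : graphAut E} {Q : Set V} {F : Finset E}
    {ν ν' : Measure (Config E)} (hν : HasRCLaw p q Q F ν)
    (hν' : HasRCLaw p q ((g : Equiv.Perm V) '' Q) (mapEdges g F) ν') {S : Set (Config E)}
    (hS : MeasurableSet S) : ν.real ((fun ω => g • ω) ⁻¹' S) = ν'.real S := by
  have hmem : ∀ A, A ∈ F.powerset ↔ mapEdges g A ∈ (mapEdges g F).powerset := fun A => by
    simp [mapEdges, Finset.map_subset_map]
  rw [hν _ (measurable_smul_config g hS), hν' _ hS]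
  congr 1
  · refine Finset.sum_equiv (mapEdges g) hmem fun A _ => ?_
    rw [weight_mapEdges, openConfig_mapEdges]
    rfl
  · exact Finset.sum_equiv (mapEdges g) hmem fun A _ => (weight_mapEdges g Q A).symm

theorem volumeEdges_map (g : graphAut E) (Λ : Finset V) :
    volumeEdges E (Λ.map (g : Equiv.Perm V).toEmbedding) = mapEdges g (volumeEdges E Λ) := by
  ext e
  rw [mem_mapEdges, mem_volumeEdges, mem_volumeEdges, coe_smul_edge]
  simp [Finset.mem_map_equiv, Sym2.mem_map]

theorem wiredSet_map (g : graphAut E) (Λ : Finset V) :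
    wiredSet E (Λ.map (g : Equiv.Perm V).toEmbedding) = (g : Equiv.Perm V) '' wiredSet E Λ := by
  ext x
  obtain ⟨x, rfl⟩ := (g : Equiv.Perm V).surjective x
  have hE : ∀ y, s((g : Equiv.Perm V) x, (g : Equiv.Perm V) y) ∈ E ↔ s(x, y) ∈ E :=
    fun y => g.2 s(x, y)
  have hΛ : ∀ y, (g : Equiv.Perm V) y ∈ Λ.map (g : Equiv.Perm V).toEmbedding ↔ y ∈ Λ :=
    fun y => by simp
  rw [(g : Equiv.Perm V).injective.mem_set_image]
  refine or_congr (not_congr (hΛ x)) (and_congr (hΛ x) ?_)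
  refine (g : Equiv.Perm V).surjective.exists.trans (exists_congr fun y => ?_)
  rw [hΛ, hE]

theorem tendsto_map_atTop (f : Equiv.Perm V) :
    Tendsto (fun Λ : Finset V => Λ.map f.toEmbedding) atTop atTop := by
  refine tendsto_atTop_atTop_of_monotone (fun _ _ h => Finset.map_subset_map.2 h) fun S =>
    ⟨S.map f.symm.toEmbedding, fun x hx => ?_⟩
  simpa [Finset.mem_map_equiv] using hx

/-- Limits of random cluster measures are invariant, because automorphisms permute the finite
volumes. -/
theorem measurePreserving_smul [Countable V] {Q : Finset V → Set V}
    (hQ : ∀ (g : graphAut E) Λ, Q (Λ.map (g : Equiv.Perm V).toEmbedding) =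
      (g : Equiv.Perm V) '' Q Λ)
    {ν : Finset V → ProbabilityMeasure (Config E)}
    (hν : ∀ Λ, HasRCLaw p q (Q Λ) (volumeEdges E Λ) (ν Λ : Measure (Config E)))
    {μ : ProbabilityMeasure (Config E)} (hμ : Tendsto ν atTop (𝓝 μ)) (g : graphAut E) :
    MeasurePreserving (fun ω : Config E => g • ω) (μ : Measure (Config E)) μ := by
  have hg := measurable_smul_config g
  refine ⟨hg, ?_⟩
  have := Measure.isProbabilityMeasure_map (μ := (μ : Measure (Config E))) hg.aemeasurable
  refine measure_ext_of_agreeOn true fun K => ?_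
  have hK := isClopen_agreeOn (ι := E) true K
  rw [map_measureReal_apply hg (measurableSet_agreeOn true K)]
  refine tendsto_nhds_unique
    (tendsto_measureReal_of_isClopen hμ (hK.preimage (continuous_smul_config g))) ?_
  refine (tendsto_measureReal_of_isClopen (hμ.comp (tendsto_map_atTop (g : Equiv.Perm V))) hK).congr
    fun Λ => ?_
  have h' := hν (Λ.map (g : Equiv.Perm V).toEmbedding)
  rw [hQ, volumeEdges_map] at h'
  exact ((hν Λ).measureReal_smul_preimage h' (measurableSet_agreeOn true K)).symm

end Invariance

/-! ### Displacing finite sets -/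

section Displacement

variable {V : Type*} {E : Set (Sym2 V)}

theorem finite_dist_le (hconn : (SimpleGraph.fromEdgeSet E).Connected) (hfin : LocallyFinite E)
    (x : V) (n : ℕ) : {y | (SimpleGraph.fromEdgeSet E).dist x y ≤ n}.Finite := by
  induction n with
  | zero => simp [hconn.dist_eq_zero_iff]
  | succ n ih =>
    refine (ih.union (ih.biUnion fun z _ => hfin z)).subset fun y hy => ?_
    obtain ⟨w, hw⟩ := hconn.exists_walk_length_eq_dist y x
    cases w with
    | nil => exact .inl (by simp)
    | @cons _ z _ hadj w =>
      refine .inr (Set.mem_biUnion (x := z) ?_ ?_)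
      · have h1 := SimpleGraph.dist_le w
        have hy' : (SimpleGraph.fromEdgeSet E).dist x y ≤ n + 1 := hy
        rw [SimpleGraph.dist_comm] at hy' h1
        rw [SimpleGraph.Walk.length_cons] at hw
        change (SimpleGraph.fromEdgeSet E).dist x z ≤ n
        omega
      · exact ((SimpleGraph.fromEdgeSet_adj E).1 hadj.symm).1

theorem dist_smul_le (hconn : (SimpleGraph.fromEdgeSet E).Connected) (g : graphAut E) (x y : V) :
    (SimpleGraph.fromEdgeSet E).dist ((g : Equiv.Perm V) x) ((g : Equiv.Perm V) y) ≤
      (SimpleGraph.fromEdgeSet E).dist x y := by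
  let f : SimpleGraph.fromEdgeSet E →g SimpleGraph.fromEdgeSet E :=
    { toFun := (g : Equiv.Perm V)
      map_rel' := by
        intro a b h
        rw [SimpleGraph.fromEdgeSet_adj] at h ⊢
        exact ⟨(g.2 s(a, b)).2 h.1, (g : Equiv.Perm V).injective.ne h.2⟩ }
  obtain ⟨w, hw⟩ := hconn.exists_walk_length_eq_dist x y
  rw [← hw, ← SimpleGraph.Walk.length_map f w]
  exact SimpleGraph.dist_le (w.map f)

/-- If one orbit is infinite, any finite set of edges can be moved off any other. -/
theorem exists_smul_notMem (hconn : (SimpleGraph.fromEdgeSet E).Connected) (hfin : LocallyFinite E)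
    (Γ : Subgroup (graphAut E)) {x : V} (hx : (MulAction.orbit Γ x).Infinite) (K F : Finset E) :
    ∃ g ∈ Γ, ∀ e ∈ K, g • e ∉ F := by
  classical
  set d := (SimpleGraph.fromEdgeSet E).dist
  -- A radius of a ball around `x` that contains all endpoints.
  let S : Finset V := (K ∪ F).biUnion fun e => (e : Sym2 V).toFinset
  have hS : ∀ e ∈ K ∪ F, ∀ y ∈ (e : Sym2 V), d x y ≤ S.sup (d x) := fun e he y hy =>
    Finset.le_sup (f := d x) (Finset.mem_biUnion.2 ⟨e, he, by simpa using hy⟩)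
  obtain ⟨_, ⟨g, rfl⟩, hg⟩ := hx.exists_notMem_finite
    (finite_dist_le hconn hfin x (S.sup (d x) + S.sup (d x)))
  refine ⟨g, g.2, fun e he heF => hg ?_⟩
  obtain ⟨y, hy⟩ : ∃ y, y ∈ (e : Sym2 V) := ⟨_, Sym2.out_fst_mem _⟩
  have h1 := hS e (Finset.mem_union_left _ he) y hy
  have h2 := hS _ (Finset.mem_union_right _ heF) _ (Sym2.mem_map.2 ⟨y, hy, rfl⟩)
  have h3 := dist_smul_le hconn (g : graphAut E) y x
  rw [SimpleGraph.dist_comm (u := y)] at h3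
  exact hconn.dist_triangle.trans (add_le_add h2 (h3.trans h1))

end Displacement

/-! ### Tail triviality and ergodicity of the limits -/

section Conclusion

variable {V : Type*} {E : Set (Sym2 V)} {p q : ℝ}

theorem ergodicSMul_of_isDecorrelated (hconn : (SimpleGraph.fromEdgeSet E).Connected)
    (hfin : LocallyFinite E) {μ : ProbabilityMeasure (Config E)}
    (hdec : ∀ A, MeasurableSet A → IsDecorrelated (μ : Measure (Config E)) A)
    (hinv : ∀ g : graphAut E,
      MeasurePreserving (fun ω : Config E => g • ω) (μ : Measure (Config E)) μ)
    (Γ : Subgroup (graphAut E)) (hΓ : ∃ x : V, (MulAction.orbit Γ x).Infinite) :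
    ErgodicSMul Γ (Config E) (μ : Measure (Config E)) where
  measure_preimage_smul g _ hS := (hinv g).measure_preimage hS.nullMeasurableSet
  aeconst_of_forall_preimage_smul_ae_eq {A} hA hAinv := by
    obtain ⟨x, hx⟩ := hΓ
    have h01 : (μ : Measure (Config E)) A = 0 ∨ (μ : Measure (Config E)) A = 1 := by
      refine measure_invariant_eq_zero_or_one hdec hA fun K F => ?_
      obtain ⟨g, hgΓ, hg⟩ := exists_smul_notMem hconn hfin Γ hx K F
      -- Relabelling coordinates by `g` is the action of `g⁻¹` on configurations.
      have hσ : (fun ω : Config E => ω ∘ fun e => g • e) = fun ω => g⁻¹ • ω := by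
        funext ω e
        simp [smul_config_apply]
      refine ⟨fun e => g • e, ?_, ?_, hg⟩
      · rw [hσ]; exact hinv g⁻¹
      · rw [hσ]; exact hAinv ⟨g⁻¹, Γ.inv_mem hgΓ⟩
    rw [eventuallyConst_set']
    rcases h01 with h | h
    · exact .inl (ae_eq_empty.2 h)
    · exact .inr ((ae_eq_univ_iff_measure_eq hA.nullMeasurableSet).2 (by simpa using h))

/-- Existence, tail triviality and ergodicity for a monotone family of random cluster measures. -/
theorem IsMonotoneFamily.existsUnique_and_trivial [Countable V]
    (hconn : (SimpleGraph.fromEdgeSet E).Connected)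
    (hfin : LocallyFinite E) {s : Bool} {Q : Finset V → Set V}
    (hQ : ∀ (g : graphAut E) Λ, Q (Λ.map (g : Equiv.Perm V).toEmbedding) =
      (g : Equiv.Perm V) '' Q Λ)
    {ν : Finset V → ProbabilityMeasure (Config E)}
    (hν : ∀ Λ, HasRCLaw p q (Q Λ) (volumeEdges E Λ) (ν Λ : Measure (Config E)))
    (hmono : IsMonotoneFamily s (volumeEdges E) ν)
    {P : ProbabilityMeasure (Config E) → Prop}
    (hP : ∀ μ, P μ ↔ ∀ Λ : ℕ → Finset V, IsExhaustion Λ →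
      WeakLimit (fun n => (ν (Λ n) : Measure (Config E))) (μ : Measure (Config E))) :
    (∃! μ, P μ) ∧ ∀ μ, P μ → TailTrivial (μ : Measure (Config E)) ∧
      ∀ Γ : Subgroup (graphAut E), (∃ x : V, (MulAction.orbit Γ x).Infinite) →
        ErgodicSMul Γ (Config E) (μ : Measure (Config E)) := by
  have hex := hmono.exists_tendsto
  have hP' : ∀ μ, P μ ↔ Tendsto ν atTop (𝓝 μ) := fun μ =>
    (hP μ).trans (forall_weakLimit_iff_tendsto hex μ)
  refine ⟨?_, fun μ hμ => ?_⟩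
  · obtain ⟨μ, hμ⟩ := hex
    exact ⟨μ, (hP' μ).2 hμ, fun μ' hμ' => tendsto_nhds_unique ((hP' μ').1 hμ') hμ⟩
  · have hlim := (hP' μ).1 hμ
    have hdec : ∀ A, MeasurableSet A → IsDecorrelated (μ : Measure (Config E)) A :=
      fun A hA => hmono.isDecorrelated hlim hA
    refine ⟨fun A hA => measure_tail_eq_zero_or_one hdec fun F => ?_, fun Γ hΓ =>
      ergodicSMul_of_isDecorrelated hconn hfin hdec (measurePreserving_smul hQ hν hlim) Γ hΓ⟩
    exact iInf_le (fun K : Finset E => cylinderEvents ((K : Set E)ᶜ)) F A hA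

end Conclusion
end RandomCluster

theorem mainTheorem2 {V : Type*} [Countable V] (E : Set (Sym2 V))
    (hconn : (SimpleGraph.fromEdgeSet E).Connected) (hfin : RandomCluster.LocallyFinite E)
    (p q : ℝ) (hp0 : 0 < p) (hp1 : p < 1) (hq : 1 ≤ q) :
    (∃! μ : ProbabilityMeasure (RandomCluster.Config E), RandomCluster.IsFreeRC E p q μ) ∧
    (∃! μ : ProbabilityMeasure (RandomCluster.Config E), RandomCluster.IsWiredRC E p q μ) ∧
    ∀ μ : ProbabilityMeasure (RandomCluster.Config E),
      (RandomCluster.IsFreeRC E p q μ ∨ RandomCluster.IsWiredRC E p q μ) →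
        RandomCluster.TailTrivial (μ : Measure (RandomCluster.Config E)) ∧
        ∀ Γ : Subgroup (RandomCluster.graphAut E),
          (∃ x : V, (MulAction.orbit Γ x).Infinite) →
            ErgodicSMul Γ (RandomCluster.Config E) (μ : Measure (RandomCluster.Config E)) := by
  open RandomCluster in
  have hfree := fun Λ => hasRCLaw_freeVolume (E := E) hp0 hp1 hq Λ
  have hwired := fun Λ => hasRCLaw_wiredVolume (E := E) hp0 hp1 hq Λ
  let νf : Finset V → ProbabilityMeasure (Config E) := fun Λ =>
    ⟨freeVolume E Λ p q, (hfree Λ).isProbabilityMeasure hp0 hp1 hq⟩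
  let νw : Finset V → ProbabilityMeasure (Config E) := fun Λ =>
    ⟨wiredVolume E Λ p q, (hwired Λ).isProbabilityMeasure hp0 hp1 hq⟩
  have hF := (isMonotoneFamily_free (ν := νf) hp0 hp1 hq hfree).existsUnique_and_trivial
    (Q := fun _ => ∅) (P := IsFreeRC E p q) hconn hfin (by simp) hfree (fun _ => Iff.rfl)
  have hW := (isMonotoneFamily_wired (ν := νw) hp0 hp1 hq hwired).existsUnique_and_trivial
    (P := IsWiredRC E p q) hconn hfin wiredSet_map hwired (fun _ => Iff.rfl)
  exact ⟨hF.1, hW.1, fun μ hμ => hμ.elim (hF.2 μ) (hW.2 μ)⟩
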